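/- **Theorem (Hölder estimates for locally uniformly elliptic equations).** Let $n\ge 1$, $0<\lambda\le\Lambda$, $b_0\ge 0$, let $B_r(x_0)\subset\mathbb{R}^n$ be the open ball of radius $r$ centred at $x_0$, and $B_r=B_r(0)$. For a symmetric matrix $M$ with eigenvalues $e_i$ (with multiplicity) let $$\mathcal{M}^-(M)=\lambda\sum_{e_i>0}e_i+\Lambda\sum_{e_i<0}e_i,\qquad \mathcal{M}^+(M)=\Lambda\sum_{e_i>0}e_i+\lambda\sum_{e_i<0}e_i .$$ For $\rho>0$ and $f:B_1\to\mathbb{R}$, a continuous function $u:B_1\to\mathbb{R}$ belongs to $S^*_\rho(\lambda,\Lambda,b_0,f)$ if for every $x_0\in B_1$ and every $\varphi\in C^2(B_1)$ with $\varphi(x_0)=u(x_0)$ and $\|D^2\varphi(x_0)\|,|D\varphi(x_0)|,|\varphi(x_0)|\le\rho$ (spectral norm of the Hessian, Euclidean norm of the gradient): - if $\varphi\le u$ near $x_0$, then $\mathcal{M}^-(D^2\varphi(x_0))-b_0|D\varphi(x_0)|\le |f(x_0)|$; - if $\varphi\ge u$ near $x_0$, then $\mathcal{M}^+(D^2\varphi(x_0))+b_0|D\varphi(x_0)|\ge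 -|f(x_0)|$. Put $$\rho_0=8\Gamma,\qquad \Gamma=\frac{(n-1)\Lambda+2b_0+1}{\lambda}+1 .$$ There exist constants $\sigma\in(0,1)$, $C>0$ and $\alpha\in(0,1)$, depending only on $n,\lambda,\Lambda,b_0$, such that for every $\rho>2\rho_0$, every $f$ with $\sup_{B_1}|f|\le\sigma$, and every $u\in S^*_\rho(\lambda,\Lambda,b_0,f)$ with $u\ge 0$ and $\sup_{B_1}|u|\le 1$: 1. $\displaystyle \operatorname{osc}_{B_r}u=\sup_{B_r}u-\inf_{B_r}u\le Cr^\alpha$ for all $\sqrt{2\rho_0/\rho}\le r\le 1$; 2. $\operatorname{osc}_{B_r(x_0)}u\le Cr^\alpha$ for all $x_0\in B_{1/2}$ and $\sqrt{2\rho_0/\rho}\le r\le \tfrac12$; 3. $|u(x_1)-u(x_2)|\le C|x_1-x_2|^\alpha$ for all $x_1,x_2\in B_{1/2}$ with $\sqrt{2\rho_0/\rho}\le|x_1-x_2|\le\tfrac12$. -/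

import Mathlib

open Metric Set Filter Topology

noncomputable section

/-- The Hessian matrix `D²φ(x)` of a function on `ℝⁿ` in the standard coordinates. -/
def hessianMatrix {n : ℕ} (φ : EuclideanSpace ℝ (Fin n) → ℝ) (x : EuclideanSpace ℝ (Fin n)) :
    Matrix (Fin n) (Fin n) ℝ :=
  Matrix.of fun i j =>
    fderiv ℝ (fderiv ℝ φ) x (EuclideanSpace.single i 1) (EuclideanSpace.single j 1)

/-- Pucci's minimal operator `λ ∑_{eᵢ > 0} eᵢ + Λ ∑_{eᵢ < 0} eᵢ`; the `eᵢ` are the eigenvalues of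
the symmetric matrix `M` with multiplicity, i.e. the roots of its characteristic polynomial. -/
def pucciMinus {n : ℕ} (lam Lam : ℝ) (M : Matrix (Fin n) (Fin n) ℝ) : ℝ :=
  lam * (M.charpoly.roots.filter (fun e => 0 < e)).sum
    + Lam * (M.charpoly.roots.filter (fun e => e < 0)).sum

/-- Pucci's maximal operator `Λ ∑_{eᵢ > 0} eᵢ + λ ∑_{eᵢ < 0} eᵢ`. -/
def pucciPlus {n : ℕ} (lam Lam : ℝ) (M : Matrix (Fin n) (Fin n) ℝ) : ℝ :=
  Lam * (M.charpoly.roots.filter (fun e => 0 < e)).sum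
    + lam * (M.charpoly.roots.filter (fun e => e < 0)).sum

/-- `φ ∈ C²(B₁)` and `‖D²φ(x₀)‖, |Dφ(x₀)|, |φ(x₀)| ≤ ρ`. The norm of the bilinear form `D²φ(x₀)`
is the spectral norm of the Hessian matrix, and that of the linear form `Dφ(x₀)` is the Euclidean
length of the gradient. -/
def IsSmallTest {n : ℕ} (ρ : ℝ) (φ : EuclideanSpace ℝ (Fin n) → ℝ)
    (x₀ : EuclideanSpace ℝ (Fin n)) : Prop :=
  ContDiffOn ℝ 2 φ (ball 0 1) ∧
    ‖fderiv ℝ (fderiv ℝ φ) x₀‖ ≤ ρ ∧ ‖fderiv ℝ φ x₀‖ ≤ ρ ∧ |φ x₀| ≤ ρ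

/-- The class `S̄_ρ(λ, Λ, b₀, f)` on the unit ball `B₁` (supersolutions). -/
def pucciSuper {n : ℕ} (ρ lam Lam b₀ : ℝ) (f : EuclideanSpace ℝ (Fin n) → ℝ) :
    Set (EuclideanSpace ℝ (Fin n) → ℝ) :=
  {u | ∀ x₀ ∈ ball (0 : EuclideanSpace ℝ (Fin n)) 1, ∀ φ : EuclideanSpace ℝ (Fin n) → ℝ,
    IsSmallTest ρ φ x₀ → φ x₀ = u x₀ → (∀ᶠ x in 𝓝 x₀, φ x ≤ u x) →
      pucciMinus lam Lam (hessianMatrix φ x₀) - b₀ * ‖fderiv ℝ φ x₀‖ ≤ f x₀}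

/-- The class `S̲_ρ(λ, Λ, b₀, f)` on the unit ball `B₁` (subsolutions). -/
def pucciSub {n : ℕ} (ρ lam Lam b₀ : ℝ) (f : EuclideanSpace ℝ (Fin n) → ℝ) :
    Set (EuclideanSpace ℝ (Fin n) → ℝ) :=
  {u | ∀ x₀ ∈ ball (0 : EuclideanSpace ℝ (Fin n)) 1, ∀ φ : EuclideanSpace ℝ (Fin n) → ℝ,
    IsSmallTest ρ φ x₀ → φ x₀ = u x₀ → (∀ᶠ x in 𝓝 x₀, u x ≤ φ x) →
      f x₀ ≤ pucciPlus lam Lam (hessianMatrix φ x₀) + b₀ * ‖fderiv ℝ φ x₀‖}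

/-- The class `S*_ρ(λ, Λ, b₀, f) = S̲_ρ(λ, Λ, b₀, -|f|) ∩ S̄_ρ(λ, Λ, b₀, |f|)`. -/
def pucciStar {n : ℕ} (ρ lam Lam b₀ : ℝ) (f : EuclideanSpace ℝ (Fin n) → ℝ) :
    Set (EuclideanSpace ℝ (Fin n) → ℝ) :=
  pucciSub ρ lam Lam b₀ (fun x => -|f x|) ∩ pucciSuper ρ lam Lam b₀ (fun x => |f x|)

/-- `Γ = ((n - 1) Λ + 2 b₀ + 1) / λ + 1`. -/
def gammaConst (n : ℕ) (lam Lam b₀ : ℝ) : ℝ :=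
  (((n : ℝ) - 1) * Lam + 2 * b₀ + 1) / lam + 1

/-- The threshold `ρ₀ = 8 Γ`. -/
def rhoZero (n : ℕ) (lam Lam b₀ : ℝ) : ℝ :=
  8 * gammaConst n lam Lam b₀

/-- The oscillation `sup_s u - inf_s u` of a function that is bounded on the non-empty set `s`. -/
def oscOn {n : ℕ} (u : EuclideanSpace ℝ (Fin n) → ℝ) (s : Set (EuclideanSpace ℝ (Fin n))) : ℝ :=
  sSup (u '' s) - sInf (u '' s)

end

/-! The proof slides paraboloids in the manner of Savin. It tests only with quadratic polynomials
whose Hessian has one eigenvalue `K ≥ 0` along a unit vector and `-κ ≤ 0` on its orthogonal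
complement; both `u` and `1 - u` are then supersolutions in the sense of `IsQuadSuper`. Throughout,
`D = (lam + N + 2 b₀ + 1) / lam`: a test with `K` a suitable multiple of `D a`, and with `κ` and
gradient comparable to `a`, contradicts the inequality as soon as `σ ≤ a`.

Slide concave paraboloids of opening `a` from below until they touch `u`. Where the contact points
are interior, the map from contact point to vertex is locally Lipschitz
(`norm_sub_le_of_touchesAt`), so a set of vertices of positive measure forces a contact set of
positive measure. This replaces the area formula and needs no second derivatives of `u`. A Gaussian
barrier (`exists_le_of_touchesAt`) carries the information "touched at `q`" to any nearby ball of
comparable size. Hence, after multiplying the opening by a fixed factor, the contact set fills a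
definite share of each such ball (`measure_closedBall_le_measure_contactSet`).

A Vitali covering makes the complement of the contact set decay geometrically in the number of such
enlargements. If `u` is tiny somewhere in the ball of radius `1/8`, then `u < 1/2` on more than half
of the ball of radius `1/4`. This cannot hold for both `u` and `1 - u`, which gives
`exists_oscillation_decay`.

Zooming in by a radius `R` turns the bound `ρ` on admissible tests into at least `ρ R²`, so the
decay can be iterated while `ρ R²` exceeds a fixed `S`. The size of `S` does not affect the explicit
threshold on `r`: the iteration stops at a radius of order `S r` instead of `r`, and the loss goes
into `C`. -/

open scoped RealInnerProductSpace ENNReal NNReal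
open MeasureTheory Module

/-! ### Touching paraboloids and the Lipschitz dependence of the vertex on the contact point. -/

section Analysis

variable {E : Type*} [NormedAddCommGroup E] [InnerProductSpace ℝ E]

/-- `u` is a supersolution on `Ω` when tested with quadratic polynomials whose Hessian is
`K e ⊗ e - κ (1 - e ⊗ e)` for a unit vector `e`; the parameter `N` stands for `(n - 1) Λ`. -/
def IsQuadSuper (lam N b₀ ρ σ : ℝ) (Ω : Set E) (u : E → ℝ) : Prop :=
  ∀ x ∈ Ω, ∀ (e p : E) (κ K : ℝ), ‖e‖ = 1 → 0 ≤ κ → 0 ≤ K → K + 2 * κ ≤ ρ → ‖p‖ ≤ ρ →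
    (∀ᶠ h in 𝓝 (0 : E),
      u x + ⟪p, h⟫ + ((K + κ) * ⟪e, h⟫ ^ 2 - κ * ‖h‖ ^ 2) / 2 ≤ u (x + h)) →
    lam * K - N * κ - b₀ * ‖p‖ ≤ σ

/-- The concave paraboloid of opening `a` and vertex `y` touches `u` from below at `x`, within the
closed unit ball. -/
def TouchesAt (u : E → ℝ) (a : ℝ) (x y : E) : Prop :=
  x ∈ closedBall (0 : E) 1 ∧
    ∀ z ∈ closedBall (0 : E) 1, u x + a / 2 * ‖x - y‖ ^ 2 ≤ u z + a / 2 * ‖z - y‖ ^ 2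

/-- The points where `u` is touched from below by a paraboloid of opening `a` with vertex in the
closed unit ball. -/
def contactSet (u : E → ℝ) (a : ℝ) : Set E :=
  {x | ∃ y ∈ closedBall (0 : E) 1, TouchesAt u a x y}

lemma norm_add_sub_sq (x y h : E) :
    ‖x + h - y‖ ^ 2 = ‖x - y‖ ^ 2 + 2 * ⟪x - y, h⟫ + ‖h‖ ^ 2 := by
  rw [show x + h - y = (x - y) + h by abel, norm_add_sq_real]

/-- Slide the polynomial `K/2 (t + 2r)² - k/2 |x - x₁|²`, with `t = ⟪e, x - x₁⟫`, under `W` in the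
slab `|t| ≤ 2r` of the ball. It exceeds `W - W x₁` by `2 K r²` at `x₁`, but on no part of the
boundary: it is nonpositive on `t = -2r`, at most `8 K r²` on `t = 2r`, and nonpositive on the
sphere because `k L² = 16 K`. So the contact is interior. -/
lemma exists_interior_touch [FiniteDimensional ℝ E] {W : E → ℝ} {x₁ e : E} {K k r L : ℝ}
    (hr : 0 < r) (hK : 0 < K) (hk : 0 < k) (hL : 0 < L) (hkL : k * L ^ 2 = 16 * K)
    (hW : ContinuousOn W (closedBall x₁ (L * r)))
    (h₁ : ∀ z ∈ closedBall x₁ (L * r), W x₁ ≤ W z)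
    (h₂ : ∀ z ∈ closedBall x₁ (L * r), ⟪e, z - x₁⟫ = 2 * r → W x₁ + 8 * K * r ^ 2 ≤ W z) :
    ∃ x ∈ ball x₁ (L * r), |⟪e, x - x₁⟫| < 2 * r ∧ ∀ᶠ h in 𝓝 (0 : E),
      W x + ⟪(K * (⟪e, x - x₁⟫ + 2 * r)) • e - k • (x - x₁), h⟫
        + (K * ⟪e, h⟫ ^ 2 - k * ‖h‖ ^ 2) / 2 ≤ W (x + h) := by
  have hcont : Continuous fun x : E => ⟪e, x - x₁⟫ := by fun_prop
  have hSc : IsCompact ({x | |⟪e, x - x₁⟫| ≤ 2 * r} ∩ closedBall x₁ (L * r)) :=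
    (isCompact_closedBall x₁ (L * r)).inter_left (isClosed_le hcont.abs continuous_const)
  have hx₁S : x₁ ∈ {x | |⟪e, x - x₁⟫| ≤ 2 * r} ∩ closedBall x₁ (L * r) := by
    refine ⟨?_, mem_closedBall_self (by positivity)⟩
    simp [hr.le]
  obtain ⟨x, ⟨htx, hxb⟩, hmin⟩ := hSc.exists_isMinOn
    (f := fun x => W x - (K / 2 * (⟪e, x - x₁⟫ + 2 * r) ^ 2 - k / 2 * ‖x - x₁‖ ^ 2))
    ⟨x₁, hx₁S⟩ (by
      have := hW.mono (inter_subset_right (s := {x | |⟪e, x - x₁⟫| ≤ 2 * r}))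
      fun_prop)
  have hneg : W x - (K / 2 * (⟪e, x - x₁⟫ + 2 * r) ^ 2 - k / 2 * ‖x - x₁‖ ^ 2)
      ≤ W x₁ - 2 * K * r ^ 2 := by
    have := hmin hx₁S
    simp only [sub_self, inner_zero_right, norm_zero, mem_ofPred_eq] at this
    linarith
  have hKr : 0 < 2 * K * r ^ 2 := by positivity
  have ht : -(2 * r) ≤ ⟪e, x - x₁⟫ ∧ ⟪e, x - x₁⟫ ≤ 2 * r := abs_le.1 (by simpa using htx)
  have hxn := mem_closedBall_iff_norm.1 hxb
  have hlow := h₁ x hxb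
  have hsqK : K / 2 * (⟪e, x - x₁⟫ + 2 * r) ^ 2 ≤ 8 * K * r ^ 2 := by
    have : (⟪e, x - x₁⟫ + 2 * r) ^ 2 ≤ (4 * r) ^ 2 := by
      apply pow_le_pow_left₀ <;> linarith
    nlinarith
  have hkn : 0 ≤ k / 2 * ‖x - x₁‖ ^ 2 := by positivity
  have ht1 : -(2 * r) < ⟪e, x - x₁⟫ := by
    rcases ht.1.lt_or_eq with h | h
    · exact h
    · exfalso
      rw [← h] at hneg
      linarith
  have ht2 : ⟪e, x - x₁⟫ < 2 * r := by
    rcases ht.2.lt_or_eq with h | h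
    · exact h
    · exfalso
      linarith [h₂ x hxb h]
  have hxb' : ‖x - x₁‖ < L * r := by
    rcases hxn.lt_or_eq with h | h
    · exact h
    · exfalso
      have h6 : k / 2 * ‖x - x₁‖ ^ 2 = 8 * K * r ^ 2 := by
        rw [h, mul_pow]
        linear_combination (r ^ 2 / 2) * hkL
      linarith
  refine ⟨x, mem_ball_iff_norm.2 hxb', abs_lt.2 ⟨ht1, ht2⟩, ?_⟩
  have hSn : ∀ᶠ h in 𝓝 (0 : E),
      x + h ∈ {x | |⟪e, x - x₁⟫| ≤ 2 * r} ∩ closedBall x₁ (L * r) := by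
    have hc : Tendsto (fun h : E => x + h) (𝓝 0) (𝓝 x) := by
      have : Continuous fun h : E => x + h := by fun_prop
      simpa using this.tendsto 0
    refine hc.eventually ?_
    have o1 : IsOpen {z : E | |⟪e, z - x₁⟫| < 2 * r} := isOpen_lt hcont.abs continuous_const
    filter_upwards [o1.mem_nhds (abs_lt.2 ⟨ht1, ht2⟩),
      isOpen_ball.mem_nhds (mem_ball_iff_norm.2 hxb')] with z hz1 hz2
    exact ⟨le_of_lt hz1, ball_subset_closedBall hz2⟩
  filter_upwards [hSn] with h hh
  have := hmin hh
  simp only [mem_ofPred_eq] at this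
  rw [norm_add_sub_sq, show x + h - x₁ = (x - x₁) + h by abel, inner_add_right] at this
  rw [inner_sub_left, inner_smul_left, inner_smul_left]
  simp only [conj_trivial]
  linarith

/-- Two paraboloids of equal opening differ by an affine function, so the second contact bounds the
first excess function below by a plane of slope `a (y₂ - y₁)`. -/
lemma add_inner_le_of_touchesAt {u : E → ℝ} {a : ℝ} {x₁ x₂ y₁ y₂ z : E}
    (h₁ : TouchesAt u a x₁ y₁) (h₂ : TouchesAt u a x₂ y₂) (hz : z ∈ closedBall (0 : E) 1) :
    u x₁ + a / 2 * ‖x₁ - y₁‖ ^ 2 + a * ⟪y₂ - y₁, z - x₂⟫ ≤ u z + a / 2 * ‖z - y₁‖ ^ 2 := by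
  have hz1 := h₂.2 z hz
  have hz2 := h₁.2 x₂ h₂.1
  have key : ∀ w : E, ‖w - y₂‖ ^ 2 =
      ‖w - y₁‖ ^ 2 - 2 * ⟪y₂ - y₁, w - y₁⟫ + ‖y₂ - y₁‖ ^ 2 := by
    intro w
    rw [show w - y₂ = (w - y₁) - (y₂ - y₁) by abel, norm_sub_sq_real, real_inner_comm]
  have hin : ⟪y₂ - y₁, z - x₂⟫ = ⟪y₂ - y₁, z - y₁⟫ - ⟪y₂ - y₁, x₂ - y₁⟫ := by
    rw [← inner_sub_right]; congr 1; abel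
  rw [key z, key x₂] at hz1
  rw [hin]
  linarith

/-- If the vertices were far apart compared with `r`, the plane of `add_inner_le_of_touchesAt` would
lift the excess over the first paraboloid by `8 K r²` on the face at distance `2r` from `x₁`. Then
`exists_interior_touch` yields a polynomial too convex along `y₂ - y₁` to touch a supersolution. -/
lemma norm_sub_le_of_touchesAt [FiniteDimensional ℝ E] {lam N b₀ ρ σ a D : ℝ} {u : E → ℝ}
    (hlam : 0 < lam) (hN : 0 ≤ N)
    (hb₀ : 0 ≤ b₀) (hD : lam * D = lam + N + 2 * b₀ + 1) (ha : 0 < a) (hσ : σ ≤ a)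
    (hρ : 12 * D * a ≤ ρ) (hu : ContinuousOn u (closedBall 0 1))
    (hsup : IsQuadSuper lam N b₀ ρ σ (ball 0 1) u)
    {x₁ x₂ y₁ y₂ : E} (hx₁ : ‖x₁‖ ≤ 1 / 4) (hy₁ : ‖y₁‖ ≤ 1) (h₁ : TouchesAt u a x₁ y₁)
    (h₂ : TouchesAt u a x₂ y₂) {r : ℝ} (hr : 0 < r) (hrD : 16 * D * r ≤ 1)
    (hxr : ‖x₁ - x₂‖ ≤ r) : ‖y₁ - y₂‖ ≤ 32 * D * r := by
  by_contra! hcon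
  have hD1 : 1 ≤ D := by
    by_contra! h
    nlinarith
  obtain ⟨d, hd⟩ : ∃ d, d = ‖y₁ - y₂‖ := ⟨_, rfl⟩
  rw [← hd] at hcon
  have hd0 : 0 < d := lt_trans (by positivity) hcon
  obtain ⟨e, he1, hde⟩ : ∃ e : E, ‖e‖ = 1 ∧ y₂ - y₁ = d • e := by
    refine ⟨d⁻¹ • (y₂ - y₁), ?_, by rw [smul_smul, mul_inv_cancel₀ hd0.ne', one_smul]⟩
    rw [norm_smul, norm_inv, norm_sub_rev, ← hd, Real.norm_of_nonneg hd0.le,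
      inv_mul_cancel₀ hd0.ne']
  -- `K` is large enough to beat `N κ`, the drift and `σ` in the final inequality; `k ≤ a` is small,
  -- and `L = 8 D` then satisfies `k L² = 16 K`.
  obtain ⟨K, hK⟩ : ∃ K, K = 4 * D * a := ⟨_, rfl⟩
  obtain ⟨k, hk⟩ : ∃ k, k = a / D := ⟨_, rfl⟩
  have hK0 : 0 < K := by rw [hK]; positivity
  have hk0 : 0 < k := by rw [hk]; positivity
  have hka : k ≤ a := by rw [hk]; exact div_le_self ha.le hD1
  have hkL : k * (8 * D) ^ 2 = 16 * K := by rw [hk, hK]; field_simp; ring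
  have hball : closedBall x₁ (8 * D * r) ⊆ ball (0 : E) 1 := by
    intro x hx
    rw [mem_closedBall_iff_norm] at hx
    rw [mem_ball_zero_iff]
    have := norm_add_le (x - x₁) x₁
    rw [sub_add_cancel] at this
    linarith
  have hball' : closedBall x₁ (8 * D * r) ⊆ closedBall (0 : E) 1 :=
    hball.trans ball_subset_closedBall
  obtain ⟨x, hxb, hxt, htouch⟩ := exists_interior_touch (e := e)
    (W := fun x => u x + a / 2 * ‖x - y₁‖ ^ 2) hr hK0 hk0 (by positivity) hkL
    (by have := hu.mono hball'; fun_prop) (fun z hz => h₁.2 z (hball' hz)) (by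
      intro z hz hzt
      have h := add_inner_le_of_touchesAt h₁ h₂ (hball' hz)
      have h3 : ⟪e, x₂ - x₁⟫ ≤ r := by
        refine (real_inner_le_norm _ _).trans ?_
        rwa [he1, one_mul, norm_sub_rev]
      rw [hde, inner_smul_left, conj_trivial, show z - x₂ = (z - x₁) - (x₂ - x₁) by abel,
        inner_sub_right, hzt] at h
      have h5 : 32 * D * r * (a * r) ≤ a * (d * (2 * r - ⟪e, x₂ - x₁⟫)) := by
        calc 32 * D * r * (a * r) ≤ d * (a * r) := by gcongr
          _ = a * (d * r) := by ring
          _ ≤ a * (d * (2 * r - ⟪e, x₂ - x₁⟫)) := by gcongr; linarith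
      have h6 : 8 * K * r ^ 2 = 32 * D * r * (a * r) := by rw [hK]; ring
      linarith)
  have hx1 := hball (ball_subset_closedBall hxb)
  have hxn := mem_ball_iff_norm.1 hxb
  obtain ⟨p, hp⟩ : ∃ p : E, p =
    (K * (⟪e, x - x₁⟫ + 2 * r)) • e - k • (x - x₁) - a • (x - y₁) := ⟨_, rfl⟩
  -- Removing the paraboloid of opening `a` adds `a` to the concave part, so `κ = k + a` and the
  -- eigenvalue along `e` is `K - k - a`.
  have htouch' : ∀ᶠ h in 𝓝 (0 : E),
      u x + ⟪p, h⟫ + (((K - k - a) + (k + a)) * ⟪e, h⟫ ^ 2 - (k + a) * ‖h‖ ^ 2) / 2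
        ≤ u (x + h) := by
    filter_upwards [htouch] with h hh
    rw [norm_add_sub_sq] at hh
    rw [hp, inner_sub_left, real_inner_smul_left (x - y₁)]
    linarith
  have hK4 : 4 * a ≤ K := by rw [hK]; nlinarith
  have hpn : ‖p‖ ≤ 4 * a := by
    have n1 : ‖(K * (⟪e, x - x₁⟫ + 2 * r)) • e‖ ≤ a := by
      have := abs_lt.1 hxt
      rw [norm_smul, he1, mul_one, Real.norm_eq_abs,
        abs_of_nonneg (mul_nonneg hK0.le (by linarith))]
      calc K * (⟪e, x - x₁⟫ + 2 * r) ≤ K * (4 * r) := by gcongr; linarith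
        _ = (16 * D * r) * a := by rw [hK]; ring
        _ ≤ 1 * a := by gcongr
        _ = a := one_mul a
    have n2 : ‖k • (x - x₁)‖ ≤ a := by
      rw [norm_smul, Real.norm_of_nonneg hk0.le]
      calc k * ‖x - x₁‖ ≤ a * 1 := by gcongr; linarith
        _ = a := mul_one a
    have n3 : ‖a • (x - y₁)‖ ≤ 2 * a := by
      rw [norm_smul, Real.norm_of_nonneg ha.le, mul_comm]
      have h7 := norm_sub_le x y₁
      rw [mem_ball_zero_iff] at hx1
      gcongr
      linarith
    have m1 := norm_sub_le ((K * (⟪e, x - x₁⟫ + 2 * r)) • e - k • (x - x₁)) (a • (x - y₁))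
    have m2 := norm_sub_le ((K * (⟪e, x - x₁⟫ + 2 * r)) • e) (k • (x - x₁))
    rw [hp]
    linarith
  have hfin := hsup x hx1 e p (k + a) (K - k - a) he1 (by positivity) (by linarith)
    (by linarith) (by linarith) htouch'
  have f1 : lam * K = 4 * a * (lam + N + 2 * b₀ + 1) := by
    rw [hK, ← hD]; ring
  have f2 : b₀ * ‖p‖ ≤ b₀ * (4 * a) := by gcongr
  have f3 : (lam + N) * k ≤ (lam + N) * a := by gcongr
  nlinarith [mul_nonneg hb₀ ha.le, mul_nonneg hN ha.le, mul_pos hlam ha]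

end Analysis

/-! ### Measure of the image of a locally Lipschitz relation. -/

section Measure

variable {E : Type*} [NormedAddCommGroup E] [InnerProductSpace ℝ E] [FiniteDimensional ℝ E]
  [MeasurableSpace E] [BorelSpace E]

/-- The relation is single-valued on `A` (take equal points in `hR`) and Lipschitz on pieces of
diameter at most `δ`; countably many disjoint pieces cover the space. Hausdorff measure suits this
because its bound for Lipschitz images needs no measurability of the set of chosen preimages. -/
lemma hausdorffMeasure_le_of_locally_lipschitz {R : E → E → Prop} {A V : Set E}
    (hA : MeasurableSet A) (hV : ∀ y ∈ V, ∃ x ∈ A, R x y) {C : ℝ≥0} {δ : ℝ} (hδ : 0 < δ)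
    (hR : ∀ x₁ ∈ A, ∀ x₂ ∈ A, ∀ y₁ y₂, R x₁ y₁ → R x₂ y₂ → dist x₁ x₂ ≤ δ →
      dist y₁ y₂ ≤ C * dist x₁ x₂) (d : ℝ) (hd : 0 ≤ d) :
    μH[d] V ≤ (C : ℝ≥0∞) ^ d * μH[d] A := by
  classical
  choose! g hgA hgR using hV
  have hinj : ∀ x ∈ A, ∀ y₁ y₂, R x y₁ → R x y₂ → y₁ = y₂ := by
    intro x hx y₁ y₂ h₁ h₂
    have := hR x hx x hx y₁ y₂ h₁ h₂ (by simpa using hδ.le)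
    rw [dist_self, mul_zero] at this
    exact dist_le_zero.1 this
  set s : ℕ → Set E := fun i => closedBall (TopologicalSpace.denseSeq E i) (δ / 2) with hs
  have hsU : ⋃ i, s i = univ := by
    refine eq_univ_of_forall fun x => mem_iUnion.2 ?_
    obtain ⟨i, hi⟩ := (TopologicalSpace.denseRange_denseSeq E).exists_dist_lt x (half_pos hδ)
    exact ⟨i, hi.le⟩
  have hm : ∀ i, MeasurableSet (disjointed s i) :=
    MeasurableSet.disjointed fun i => measurableSet_closedBall
  have hpiece : ∀ i, μH[d] {y ∈ V | g y ∈ disjointed s i} ≤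
      (C : ℝ≥0∞) ^ d * μH[d] (A ∩ disjointed s i) := by
    intro i
    set Vi := {y ∈ V | g y ∈ disjointed s i} with hVi
    -- The choice `g` is injective on `V`, so its inverse on `g '' Vi` is the Lipschitz map that
    -- recovers `Vi`.
    have hsub : Vi ⊆ Function.invFunOn g Vi '' (g '' Vi) := by
      intro y hy
      have h1 : g y ∈ g '' Vi := mem_image_of_mem g hy
      refine ⟨g y, h1, ?_⟩
      have h2 := Function.invFunOn_mem h1
      have h3 := Function.invFunOn_eq h1
      have h4 := hgR _ h2.1
      rw [h3] at h4
      exact hinj _ (hgA y hy.1) _ _ h4 (hgR y hy.1)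
    have hlip : LipschitzOnWith C (Function.invFunOn g Vi) (g '' Vi) := by
      refine LipschitzOnWith.of_dist_le_mul fun x₁ hx₁ x₂ hx₂ => ?_
      have a1 := Function.invFunOn_mem hx₁
      have a2 := Function.invFunOn_mem hx₂
      have b1 := Function.invFunOn_eq hx₁
      have b2 := Function.invFunOn_eq hx₂
      have c1 := hgR _ a1.1
      have c2 := hgR _ a2.1
      have e1 := a1.2
      have e2 := a2.2
      have f1 := hgA _ a1.1
      have f2 := hgA _ a2.1
      rw [b1] at c1 e1 f1
      rw [b2] at c2 e2 f2
      refine hR x₁ f1 x₂ f2 _ _ c1 c2 ?_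
      have h1 := mem_closedBall.1 (disjointed_le s i e1)
      have h2 := mem_closedBall.1 (disjointed_le s i e2)
      have := dist_triangle_right x₁ x₂ (TopologicalSpace.denseSeq E i)
      linarith
    calc μH[d] Vi ≤ μH[d] (Function.invFunOn g Vi '' (g '' Vi)) := measure_mono hsub
      _ ≤ (C : ℝ≥0∞) ^ d * μH[d] (g '' Vi) := hlip.hausdorffMeasure_image_le hd
      _ ≤ (C : ℝ≥0∞) ^ d * μH[d] (A ∩ disjointed s i) := by
        gcongr
        rintro _ ⟨y, hy, rfl⟩
        exact ⟨hgA y hy.1, hy.2⟩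
  have hVU : V ⊆ ⋃ i, {y ∈ V | g y ∈ disjointed s i} := by
    intro y hy
    have : g y ∈ ⋃ i, disjointed s i := by rw [iUnion_disjointed, hsU]; trivial
    obtain ⟨i, hi⟩ := mem_iUnion.1 this
    exact mem_iUnion.2 ⟨i, hy, hi⟩
  have hAU : μH[d] A = ∑' i, μH[d] (A ∩ disjointed s i) := by
    rw [← measure_iUnion, ← inter_iUnion, iUnion_disjointed, hsU, inter_univ]
    · intro i j hij
      exact ((disjoint_disjointed s) hij).mono inter_subset_right inter_subset_right
    · exact fun i => hA.inter (hm i)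
  calc μH[d] V ≤ μH[d] (⋃ i, {y ∈ V | g y ∈ disjointed s i}) := measure_mono hVU
    _ ≤ ∑' i, μH[d] {y ∈ V | g y ∈ disjointed s i} := measure_iUnion_le _
    _ ≤ ∑' i, (C : ℝ≥0∞) ^ d * μH[d] (A ∩ disjointed s i) := ENNReal.tsum_le_tsum hpiece
    _ = (C : ℝ≥0∞) ^ d * μH[d] A := by rw [ENNReal.tsum_mul_left, hAU]

end Measure

/-! ### Vitali covering. -/

section Covering

variable {E : Type*} [NormedAddCommGroup E] [InnerProductSpace ℝ E] [FiniteDimensional ℝ E]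
  [MeasurableSpace E]

/-- A Vitali covering argument: if each point of `Q \ F` is the centre of a ball that contains a
definite portion of `G \ F`, then `G` covers a definite portion of `Q \ F`. -/
lemma measure_diff_le_of_forall_exists_piece (μ : Measure E) 
    {Q F G : Set E} {C : ℝ≥0∞} {R : ℝ}
    (h : ∀ x ∈ Q \ F, ∃ r, 0 < r ∧ r ≤ R ∧ ∃ P, MeasurableSet P ∧ P ⊆ Q ∩ (G \ F) ∧
      P ⊆ closedBall x (r / 4) ∧ μ (closedBall x (5 / 4 * r)) ≤ C * μ P) :
    μ (Q \ F) ≤ C * μ (Q ∩ (G \ F)) := by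
  choose! r hr0 hrR P hPm hPQ hPb hPμ using h
  obtain ⟨t, htQ, htd, htc⟩ := Vitali.exists_disjoint_subfamily_covering_enlargement_closedBall
    (Q \ F) id (fun x => r x / 4) (R / 4) (fun x hx => by have := hrR x hx; linarith) 5
    (by norm_num)
  have htcount : t.Countable := by
    refine htd.countable_of_nonempty_interior fun x hx => ?_
    have : 0 < r x / 4 := by have := hr0 x (htQ hx); positivity
    exact ⟨x, ball_subset_interior_closedBall (mem_ball_self this)⟩
  have hcover : Q \ F ⊆ ⋃ x ∈ t, closedBall x (5 / 4 * r x) := by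
    intro x hx
    obtain ⟨y, hy, hxy⟩ := htc x hx
    refine mem_iUnion₂.2 ⟨y, hy, ?_⟩
    have h1 : 0 ≤ r x / 4 := by have := hr0 x hx; positivity
    rw [show 5 / 4 * r y = 5 * (r y / 4) by ring]
    exact hxy (mem_closedBall_self h1)
  have : Countable t := htcount.to_subtype
  calc μ (Q \ F) ≤ μ (⋃ x ∈ t, closedBall x (5 / 4 * r x)) := measure_mono hcover
    _ ≤ ∑' x : t, μ (closedBall (x : E) (5 / 4 * r x)) := measure_biUnion_le μ htcount _
    _ ≤ ∑' x : t, C * μ (P x) := ENNReal.tsum_le_tsum fun x => hPμ x (htQ x.2)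
    _ = C * ∑' x : t, μ (P x) := ENNReal.tsum_mul_left
    _ = C * μ (⋃ x ∈ t, P x) := by
      rw [measure_biUnion htcount]
      · intro x hx y hy hxy
        exact (htd hx hy hxy).mono (hPb x (htQ hx)) (hPb y (htQ hy))
      · exact fun x hx => hPm x (htQ hx)
    _ ≤ C * μ (Q ∩ (G \ F)) := by
      gcongr
      exact iUnion₂_subset fun x hx => hPQ x (htQ hx)

end Covering

/-! ### The Gaussian barrier. -/

section Barrier

variable {E : Type*} [NormedAddCommGroup E] [InnerProductSpace ℝ E]

lemma one_add_add_sq_div_four_le_exp {t : ℝ} (ht : |t| ≤ 1) : 1 + t + t ^ 2 / 4 ≤ Real.exp t := by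
  have h := Real.exp_bound ht (n := 3) (by norm_num)
  simp only [Finset.sum_range_succ, Finset.sum_range_zero, Nat.factorial] at h
  norm_num at h
  have h1 := (abs_le.1 h).1
  have h2 : |t| ^ 3 ≤ t ^ 2 := by
    rw [← sq_abs t]
    nlinarith [sq_nonneg |t|, abs_nonneg t]
  nlinarith [sq_nonneg t]

/-- A second order lower bound for the Gaussian at a point. -/
lemma gaussian_lower_bound (ξ : E) {b : ℝ} (hb : 0 < b) :
    ∀ᶠ h in 𝓝 (0 : E), Real.exp (-b * ‖ξ‖ ^ 2)
      * (1 - 2 * b * ⟪ξ, h⟫ + (b ^ 2 * ⟪ξ, h⟫ ^ 2 - 4 * b * ‖h‖ ^ 2) / 2)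
        ≤ Real.exp (-b * ‖ξ + h‖ ^ 2) := by
  have c1 : Continuous fun h : E => |-b * (2 * ⟪ξ, h⟫ + ‖h‖ ^ 2)| := by fun_prop
  have c2 : Continuous fun h : E => b * ‖h‖ ^ 2 := by fun_prop
  have e1 : ∀ᶠ h in 𝓝 (0 : E), |-b * (2 * ⟪ξ, h⟫ + ‖h‖ ^ 2)| < 1 :=
    (c1.tendsto 0).eventually_lt_const (by simp)
  have e2 : ∀ᶠ h in 𝓝 (0 : E), b * ‖h‖ ^ 2 < 1 := (c2.tendsto 0).eventually_lt_const (by simp)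
  filter_upwards [e1, e2] with h h1 h2
  have h3 := one_add_add_sq_div_four_le_exp h1.le
  have h4 : -b * ‖ξ + h‖ ^ 2 = -b * ‖ξ‖ ^ 2 + -b * (2 * ⟪ξ, h⟫ + ‖h‖ ^ 2) := by
    rw [norm_add_sq_real]; ring
  rw [h4, Real.exp_add]
  gcongr
  refine le_trans ?_ h3
  have h5 : 0 ≤ b * ‖h‖ ^ 2 := by positivity
  have h6 : (b * ‖h‖ ^ 2) ^ 2 ≤ b * ‖h‖ ^ 2 := by nlinarith
  nlinarith [sq_nonneg (b * ⟪ξ, h⟫ + b * ‖h‖ ^ 2)]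

/-- The constant of the barrier: `β = 1280 (D + 1)` is the exponent of the Gaussian. -/
noncomputable def barrierConst (D : ℝ) : ℝ :=
  1280 * (D + 1) * Real.exp (25 / 16 * (1280 * (D + 1)))

/-- A supersolution is not touched from below by a steep Gaussian away from its centre. -/
lemma not_eventually_gaussian_le {lam N b₀ ρ σ a D b τ : ℝ} {u : E → ℝ}
    (hlam : 0 < lam) (hN : 0 ≤ N) (hb₀ : 0 ≤ b₀) (hD : lam * D = lam + N + 2 * b₀ + 1)
    (hD1 : 1 ≤ D) (ha : 0 < a) (hσ : σ ≤ a) (haτ : a ≤ τ) (hρ : τ * (2010 * (D + 1)) ≤ ρ)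
    {x x₁ y : E} (hsup : IsQuadSuper lam N b₀ ρ σ (ball 0 1) u) (hx : x ∈ ball (0 : E) 1)
    (hy : ‖y‖ ≤ 1) (hs0 : 0 < ‖x - x₁‖) (hs1 : ‖x - x₁‖ ≤ 1)
    (hbs1 : 5 * (D + 1) ≤ b * ‖x - x₁‖ ^ 2) (hbs2 : b * ‖x - x₁‖ ^ 2 ≤ 2000 * (D + 1)) :
    ¬ ∀ᶠ h in 𝓝 (0 : E), u x + a / 2 * ‖x - y‖ ^ 2
      + τ * (-2 * ⟪x - x₁, h⟫ + (b * ⟪x - x₁, h⟫ ^ 2 - 4 * ‖h‖ ^ 2) / 2)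
        ≤ u (x + h) + a / 2 * ‖x + h - y‖ ^ 2 := by
  intro hev
  have hτ0 : 0 < τ := ha.trans_le haτ
  obtain ⟨s, hs⟩ : ∃ s, s = ‖x - x₁‖ := ⟨_, rfl⟩
  rw [← hs] at hs0 hs1 hbs1 hbs2
  obtain ⟨e, he1, hxe⟩ : ∃ e : E, ‖e‖ = 1 ∧ x - x₁ = s • e := by
    refine ⟨s⁻¹ • (x - x₁), ?_, by rw [smul_smul, mul_inv_cancel₀ hs0.ne', one_smul]⟩
    rw [norm_smul, norm_inv, ← hs, Real.norm_of_nonneg hs0.le, inv_mul_cancel₀ hs0.ne']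
  obtain ⟨p, hp⟩ : ∃ p : E, p = -((2 * τ) • (x - x₁)) - a • (x - y) := ⟨_, rfl⟩
  have hpn : ‖p‖ ≤ 4 * τ := by
    have n1 : ‖-((2 * τ) • (x - x₁))‖ ≤ 2 * τ * 1 := by
      rw [norm_neg, norm_smul, Real.norm_of_nonneg (by positivity), ← hs]
      gcongr
    have n2 : ‖a • (x - y)‖ ≤ τ * 2 := by
      rw [norm_smul, Real.norm_of_nonneg ha.le]
      have := norm_sub_le x y
      rw [mem_ball_zero_iff] at hx
      gcongr
      linarith
    have := norm_sub_le (-((2 * τ) • (x - x₁))) (a • (x - y))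
    rw [hp]
    linarith
  have htouch : ∀ᶠ h in 𝓝 (0 : E),
      u x + ⟪p, h⟫ + (((τ * (b * s ^ 2) - 4 * τ - a) + (4 * τ + a)) * ⟪e, h⟫ ^ 2
        - (4 * τ + a) * ‖h‖ ^ 2) / 2 ≤ u (x + h) := by
    filter_upwards [hev] with h h1
    rw [norm_add_sub_sq] at h1
    rw [hp, inner_sub_left, inner_neg_left, real_inner_smul_left, real_inner_smul_left (x - y)]
    have h3 : ⟪x - x₁, h⟫ ^ 2 = s ^ 2 * ⟪e, h⟫ ^ 2 := by
      rw [hxe, real_inner_smul_left]; ring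
    rw [h3] at h1
    linarith
  have hK0 : τ * (5 * (D + 1)) ≤ τ * (b * s ^ 2) := by gcongr
  have hK1 : τ * (b * s ^ 2) ≤ τ * (2000 * (D + 1)) := by gcongr
  have hτD : τ * 1 ≤ τ * D := by gcongr
  have hfin := hsup x hx e p (4 * τ + a) (τ * (b * s ^ 2) - 4 * τ - a) he1 (by positivity)
    (by linarith) (by linarith) (by linarith) htouch
  have f1 : lam * (τ * (5 * (D + 1))) = 5 * τ * (lam + N + 2 * b₀ + 1) + 5 * lam * τ := by
    rw [← hD]; ring
  have f0 : lam * (τ * (5 * (D + 1))) ≤ lam * (τ * (b * s ^ 2)) := by gcongr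
  have f2 : b₀ * ‖p‖ ≤ b₀ * (4 * τ) := by gcongr
  have f3 : (lam + N) * (4 * τ + a) ≤ (lam + N) * (5 * τ) := by gcongr; linarith
  have g1 := mul_nonneg hb₀ hτ0.le
  have g2 := mul_nonneg hN hτ0.le
  have g3 := mul_pos hlam hτ0
  linarith

/-- If `u` is touched from below at `q` by a paraboloid of opening `a`, then near `q` there is a
point in each ball of comparable radius at which `u` is not much larger than the paraboloid. -/
lemma exists_le_of_touchesAt [FiniteDimensional ℝ E] {lam N b₀ ρ σ a D : ℝ} {u : E → ℝ}
    (hlam : 0 < lam) (hN : 0 ≤ N) (hb₀ : 0 ≤ b₀) (hD : lam * D = lam + N + 2 * b₀ + 1)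
    (ha : 0 < a) (hσ : σ ≤ a) (hρ : 2010 * (D + 1) * barrierConst D * a ≤ ρ)
    (hu : ContinuousOn u (closedBall 0 1)) (hsup : IsQuadSuper lam N b₀ ρ σ (ball 0 1) u)
    {q y x₁ : E} (hy : ‖y‖ ≤ 1) (hq : TouchesAt u a q y) (hx₁ : ‖x₁‖ ≤ 1 / 4) {r : ℝ}
    (hr : 0 < r) (hr2 : r ≤ 1 / 2) (hqx : ‖q - x₁‖ ≤ 9 / 8 * r) :
    ∃ z, ‖z - x₁‖ ≤ r / 16 ∧
      u z + a / 2 * ‖z - y‖ ^ 2 ≤ u q + a / 2 * ‖q - y‖ ^ 2 + barrierConst D * a * r ^ 2 := by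
  have hD1 : 1 ≤ D := by
    by_contra! h
    nlinarith
  -- With `b = β / r²`, the quantity `b |x - x₁|²` is `β / 256 = 5 (D + 1)` at radius `r / 16` and
  -- `25/16 β = 2000 (D + 1)` at radius `5/4 r`: the two bounds required by
  -- `not_eventually_gaussian_le`.
  obtain ⟨β, hβ⟩ : ∃ β, β = 1280 * (D + 1) := ⟨_, rfl⟩
  have hβ1 : 2560 ≤ β := by rw [hβ]; linarith
  have hβ0 : 0 < β := by linarith
  -- `X⁻¹` is the value of the Gaussian on the sphere of radius `5/4 r`; the height `H = X a r²`
  -- therefore keeps its curvature at least `β a` in the whole ball.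
  obtain ⟨X, hX⟩ : ∃ X, X = Real.exp (25 / 16 * β) := ⟨_, rfl⟩
  have hX1 : 1 ≤ X := by rw [hX]; exact Real.one_le_exp (by positivity)
  have hXinv : Real.exp (-(25 / 16 * β)) = X⁻¹ := by rw [hX, Real.exp_neg]
  have hbc : barrierConst D = β * X := by rw [barrierConst, hX, hβ]
  obtain ⟨b, hb⟩ : ∃ b, b = β / r ^ 2 := ⟨_, rfl⟩
  have hb0 : 0 < b := by rw [hb]; positivity
  have hbr : b * r ^ 2 = β := by rw [hb]; field_simp
  obtain ⟨H, hH⟩ : ∃ H, H = X * a * r ^ 2 := ⟨_, rfl⟩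
  have hH0 : 0 < H := by rw [hH]; positivity
  obtain ⟨g, hg⟩ : ∃ g : E → ℝ, g = fun z => Real.exp (-b * ‖z - x₁‖ ^ 2) := ⟨_, rfl⟩
  have hball : closedBall x₁ (5 / 4 * r) ⊆ ball (0 : E) 1 := by
    intro x hx
    rw [mem_closedBall_iff_norm] at hx
    rw [mem_ball_zero_iff]
    have := norm_add_le (x - x₁) x₁
    rw [sub_add_cancel] at this
    linarith
  have hball' := hball.trans ball_subset_closedBall
  have hqb : q ∈ closedBall x₁ (5 / 4 * r) := mem_closedBall_iff_norm.2 (by linarith)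
  obtain ⟨x, hxb, hmin⟩ := (isCompact_closedBall x₁ (5 / 4 * r)).exists_isMinOn
    (f := fun z => u z + a / 2 * ‖z - y‖ ^ 2 - H * g z) ⟨q, hqb⟩ (by
      have := hu.mono hball'
      rw [hg]
      fun_prop)
  have hgq : X⁻¹ < g q := by
    rw [hg, ← hXinv]
    apply Real.exp_lt_exp.2
    have : b * ‖q - x₁‖ ^ 2 ≤ b * (9 / 8 * r) ^ 2 := by gcongr
    linarith
  have hlow := hq.2 x (hball' hxb)
  have hneg : u x + a / 2 * ‖x - y‖ ^ 2 - H * g x ≤ u q + a / 2 * ‖q - y‖ ^ 2 - H * g q :=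
    hmin hqb
  -- Since `q` minimises `u` plus the paraboloid, the new minimiser `x` can only win by a larger
  -- Gaussian. It is thus no farther from `x₁` than `q`, hence off the boundary.
  have hgx : X⁻¹ < g x := lt_of_lt_of_le hgq (le_of_mul_le_mul_left (by linarith) hH0)
  have hx1 := hball hxb
  have hxlt : ‖x - x₁‖ < 5 / 4 * r := by
    by_contra! h
    refine hgx.not_ge ?_
    rw [hg, ← hXinv]
    apply Real.exp_le_exp.2
    have : b * (5 / 4 * r) ^ 2 ≤ b * ‖x - x₁‖ ^ 2 := by gcongr
    linarith
  have hgx1 : g x ≤ 1 := by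
    rw [hg]
    exact Real.exp_le_one_iff.2 (by have : 0 ≤ b * ‖x - x₁‖ ^ 2 := by positivity
                                    linarith)
  have hgx0 : 0 < g x := by rw [hg]; positivity
  refine ⟨x, ?_, ?_⟩
  swap
  · have h1 : H * g x ≤ H * 1 := by gcongr
    have h2 : 0 ≤ H * g q := mul_nonneg hH0.le (by rw [hg]; positivity)
    have h3 : H ≤ barrierConst D * a * r ^ 2 := by
      rw [hbc, hH]
      have : 0 ≤ X * a * r ^ 2 := by positivity
      rw [show β * X * a * r ^ 2 = β * (X * a * r ^ 2) by ring]
      exact le_mul_of_one_le_left this (by linarith)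
    linarith
  -- Outside the ball of radius `r / 16` the barrier is steep enough to contradict the supersolution
  -- property.
  by_contra! hfar
  obtain ⟨τ, hτ⟩ : ∃ τ, τ = b * (H * g x) := ⟨_, rfl⟩
  have hbH : b * H = β * X * a := by rw [hH, ← hbr]; ring
  have hτ1 : τ ≤ β * X * a := by
    rw [hτ, ← mul_assoc, hbH]
    exact mul_le_of_le_one_right (by positivity) hgx1
  have hτ2 : β * a ≤ τ := by
    rw [hτ, ← mul_assoc, hbH]
    calc β * a = β * X * a * X⁻¹ := by field_simp
      _ ≤ β * X * a * g x := by gcongr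
  have hτa : a ≤ τ := by
    refine le_trans ?_ hτ2
    exact le_mul_of_one_le_left ha.le (by linarith)
  have hbs1 : 5 * (D + 1) ≤ b * ‖x - x₁‖ ^ 2 := by
    have : b * (r / 16) ^ 2 ≤ b * ‖x - x₁‖ ^ 2 := by gcongr
    linarith
  have hbs2 : b * ‖x - x₁‖ ^ 2 ≤ 2000 * (D + 1) := by
    have : b * ‖x - x₁‖ ^ 2 ≤ b * (5 / 4 * r) ^ 2 := by gcongr
    linarith
  have hρ' : τ * (2010 * (D + 1)) ≤ ρ := by
    calc τ * (2010 * (D + 1)) ≤ β * X * a * (2010 * (D + 1)) := by gcongr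
      _ = 2010 * (D + 1) * barrierConst D * a := by rw [hbc]; ring
      _ ≤ ρ := hρ
  have hnear : ∀ᶠ h in 𝓝 (0 : E), x + h ∈ closedBall x₁ (5 / 4 * r) := by
    have hc : Tendsto (fun h : E => x + h) (𝓝 0) (𝓝 x) := by
      have : Continuous fun h : E => x + h := by fun_prop
      simpa using this.tendsto 0
    refine hc.eventually ?_
    filter_upwards [isOpen_ball.mem_nhds (mem_ball_iff_norm.2 hxlt)] with z hz
    exact ball_subset_closedBall hz
  refine not_eventually_gaussian_le hlam hN hb₀ hD hD1 ha hσ hτa hρ' hsup hx1 hy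
    (lt_trans (by positivity) hfar) (by linarith) hbs1 hbs2 ?_
  filter_upwards [hnear, gaussian_lower_bound (x - x₁) hb0] with h hh hgauss
  have h1 : u x + a / 2 * ‖x - y‖ ^ 2 - H * g x
    ≤ u (x + h) + a / 2 * ‖x + h - y‖ ^ 2 - H * g (x + h) := hmin hh
  have h2 : H * (g x * (1 - 2 * b * ⟪x - x₁, h⟫
      + (b ^ 2 * ⟪x - x₁, h⟫ ^ 2 - 4 * b * ‖h‖ ^ 2) / 2)) ≤ H * g (x + h) := by
    gcongr
    rw [hg]
    simp only
    rwa [show x + h - x₁ = x - x₁ + h by abel]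
  rw [hτ]
  linarith

end Barrier

/-! ### Growth of the contact set when the opening increases. -/

section Growth

variable {E : Type*} [NormedAddCommGroup E] [InnerProductSpace ℝ E]

lemma exists_touchesAt [FiniteDimensional ℝ E] {u : E → ℝ} (hu : ContinuousOn u (closedBall 0 1))
    (a : ℝ) (y : E) : ∃ x, TouchesAt u a x y := by
  obtain ⟨x, hx, hmin⟩ := (isCompact_closedBall (0 : E) 1).exists_isMinOn
    (f := fun z => u z + a / 2 * ‖z - y‖ ^ 2) ⟨0, by simp⟩ (by fun_prop)
  exact ⟨x, hx, fun z hz => hmin hz⟩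

lemma isClosed_contactSet [FiniteDimensional ℝ E] {u : E → ℝ}
    (hu : ContinuousOn u (closedBall 0 1)) (a : ℝ) : IsClosed (contactSet u a) := by
  have hB : IsCompact (closedBall (0 : E) 1 ×ˢ closedBall (0 : E) 1) :=
    (isCompact_closedBall _ _).prod (isCompact_closedBall _ _)
  have h1 : ContinuousOn (fun p : E × E => u p.1)
      (closedBall (0 : E) 1 ×ˢ closedBall (0 : E) 1) :=
    hu.comp continuousOn_fst fun p hp => hp.1
  have h2 : ∀ z : E, IsClosed {p ∈ closedBall (0 : E) 1 ×ˢ closedBall (0 : E) 1 |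
      u p.1 + a / 2 * ‖p.1 - p.2‖ ^ 2 ≤ u z + a / 2 * ‖z - p.2‖ ^ 2} := fun z =>
    hB.isClosed.isClosed_le
      (h1.add (f := fun p : E × E => u p.1) (g := fun p : E × E => a / 2 * ‖p.1 - p.2‖ ^ 2)
        (by fun_prop)) (by fun_prop)
  have h3 : contactSet u a = Prod.fst '' ((closedBall (0 : E) 1 ×ˢ closedBall (0 : E) 1) ∩
      ⋂ z ∈ closedBall (0 : E) 1, {p ∈ closedBall (0 : E) 1 ×ˢ closedBall (0 : E) 1 |
        u p.1 + a / 2 * ‖p.1 - p.2‖ ^ 2 ≤ u z + a / 2 * ‖z - p.2‖ ^ 2}) := by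
    ext x
    constructor
    · rintro ⟨y, hy, hx, hxy⟩
      exact ⟨(x, y), ⟨⟨hx, hy⟩, mem_iInter₂.2 fun z hz => ⟨⟨hx, hy⟩, hxy z hz⟩⟩, rfl⟩
    · rintro ⟨⟨x, y⟩, ⟨hxy, h⟩, rfl⟩
      exact ⟨y, hxy.2, hxy.1, fun z hz => (mem_iInter₂.1 h z hz).2⟩
  rw [h3]
  exact ((hB.inter_right (isClosed_biInter fun z _ => h2 z)).image continuous_fst).isClosed

/-- Two paraboloids of openings `a` and `M a` add up to one whose vertex is a weighted mean. -/
lemma add_paraboloid_eq (a M : ℝ) (v η w : E) :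
    a / 2 * ‖w - (v - M • η)‖ ^ 2 + M * a / 2 * ‖w - (v + η)‖ ^ 2
      = (1 + M) * a / 2 * ‖w - v‖ ^ 2 + M * (1 + M) * a / 2 * ‖η‖ ^ 2 := by
  rw [show w - (v - M • η) = (w - v) + M • η by abel, show w - (v + η) = (w - v) - η by abel,
    norm_add_sq_real (w - v), norm_sub_sq_real (w - v) η, inner_smul_right, norm_smul, Real.norm_eq_abs, mul_pow,
    sq_abs]
  ring

/-- Move the vertex along the segment from `y` towards `x`, so that the paraboloid to be added has
its vertex at `x` itself and cannot destroy the contact. -/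
lemma contactSet_mono {u : E → ℝ} {a M : ℝ} (ha : 0 < a) (hM : 0 ≤ M) :
    contactSet u a ⊆ contactSet u ((1 + M) * a) := by
  rintro x ⟨y, hy, hx, hxy⟩
  have hM' : 0 < 1 + M := by linarith
  obtain ⟨η, hη⟩ : ∃ η : E, η = (1 + M)⁻¹ • (x - y) := ⟨_, rfl⟩
  have hη' : x - y = (1 + M) • η := by rw [hη, smul_smul, mul_inv_cancel₀ hM'.ne', one_smul]
  have e1 : x - η + η = x := by abel
  have e2 : x - η - M • η = y := by
    rw [add_smul, one_smul] at hη'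
    rw [sub_sub, ← hη']
    abel
  refine ⟨x - η, ?_, hx, fun z hz => ?_⟩
  · have h1 : x - η = (M / (1 + M)) • x + (1 / (1 + M)) • y := by
      rw [hη]
      match_scalars <;> field_simp
      ring
    rw [h1]
    exact convex_closedBall (0 : E) 1 hx hy (by positivity) (by positivity) (by field_simp; ring)
  · have p1 := add_paraboloid_eq a M (x - η) η x
    have p2 := add_paraboloid_eq a M (x - η) η z
    rw [e1, e2] at p1 p2
    have h1 := hxy z hz
    have h2 : 0 ≤ M * a / 2 * ‖z - x‖ ^ 2 := by positivity
    rw [sub_self, norm_zero] at p1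
    linarith

variable [FiniteDimensional ℝ E] [MeasurableSpace E] [BorelSpace E]

/-- The factor by which the opening grows in one step of the covering argument, minus one. -/
noncomputable def openingFactor (D : ℝ) : ℝ :=
  2048 * barrierConst D

lemma one_le_barrierConst {D : ℝ} (hD : 1 ≤ D) : 1 ≤ barrierConst D := by
  have : 1 ≤ Real.exp (25 / 16 * (1280 * (D + 1))) := Real.one_le_exp (by linarith)
  rw [barrierConst]
  nlinarith

/-- Add to the paraboloid touching at `q` one of opening `M a` with vertex near the point `z`
supplied by the barrier. The sum has opening `(1 + M) a`, and the excess at `z` is too small for the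
new contact to leave the ball of radius `r / 8`. The vertices of the sums fill a ball of radius `r /
128`, and the Lipschitz bound transfers its measure to the contact points. -/
lemma measure_closedBall_le_measure_contactSet {lam N b₀ ρ σ a D : ℝ} {u : E → ℝ}
    (hlam : 0 < lam) (hN : 0 ≤ N) (hb₀ : 0 ≤ b₀) (hD : lam * D = lam + N + 2 * b₀ + 1)
    (ha : 0 < a) (hσ : σ ≤ a) (hρ : 2010 * (D + 1) * (1 + openingFactor D) * a ≤ ρ)
    (hu : ContinuousOn u (closedBall 0 1)) (hsup : IsQuadSuper lam N b₀ ρ σ (ball 0 1) u)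
    {q x₁ : E} (hq : q ∈ contactSet u a) {r : ℝ} (hr : 0 < r) (hr2 : r ≤ 1 / 2)
    (hx₁ : ‖x₁‖ + r / 8 ≤ 1 / 4) (hqx : ‖q - x₁‖ ≤ 9 / 8 * r) (c : E) :
    μH[finrank ℝ E] (closedBall c (r / 128)) ≤ ((32 * D).toNNReal : ℝ≥0∞) ^ (finrank ℝ E : ℝ) *
      μH[finrank ℝ E] (contactSet u ((1 + openingFactor D) * a) ∩ ball x₁ (r / 8)) := by
  have hD1 : 1 ≤ D := by
    by_contra! h
    nlinarith
  have hB := one_le_barrierConst hD1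
  obtain ⟨B, hBd⟩ : ∃ B, B = barrierConst D := ⟨_, rfl⟩
  obtain ⟨M, hM⟩ : ∃ M, M = openingFactor D := ⟨_, rfl⟩
  have hMB : M = 2048 * B := by rw [hM, openingFactor, hBd]
  rw [← hBd] at hB
  rw [← hM] at hρ ⊢
  have hM1 : 2048 ≤ M := by linarith
  have hM0 : 0 < 1 + M := by linarith
  obtain ⟨y₁, hy₁, hqy⟩ := hq
  have hρ1 : 2010 * (D + 1) * barrierConst D * a ≤ ρ := by
    refine le_trans ?_ hρ
    rw [← hBd]
    gcongr
    linarith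
  have hρ2 : 12 * D * ((1 + M) * a) ≤ ρ := by
    refine le_trans ?_ hρ
    rw [mul_assoc (2010 * (D + 1))]
    gcongr ?_ * _
    linarith
  obtain ⟨z, hz, hzu⟩ := exists_le_of_touchesAt hlam hN hb₀ hD ha hσ hρ1 hu hsup
    (mem_closedBall_zero_iff.1 hy₁) hqy (by linarith) hr hr2 hqx
  rw [← hBd] at hzu
  have hz4 : ‖z‖ ≤ 1 / 4 := by
    have := norm_add_le (z - x₁) x₁
    rw [sub_add_cancel] at this
    linarith
  -- The centre is irrelevant to the measure; the one chosen is the vertex of the sum when the added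
  -- paraboloid has its vertex exactly at `z`.
  rw [Measure.addHaar_closedBall_center, ← Measure.addHaar_closedBall_center (μ := μH[finrank ℝ E])
    (z + (1 + M)⁻¹ • (y₁ - z))]
  refine hausdorffMeasure_le_of_locally_lipschitz
    (R := fun x y => ‖y‖ ≤ 1 ∧ TouchesAt u ((1 + M) * a) x y) (δ := 1 / (16 * D))
    ((isClosed_contactSet hu _).measurableSet.inter measurableSet_ball) ?_ (by positivity) ?_ _
    (by positivity)
  · intro v hv
    rw [mem_closedBall_iff_norm] at hv
    -- The added paraboloid has vertex `v + η`, and `v - M • η = y₁` makes `v` the vertex of the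
    -- sum.
    obtain ⟨η, hη⟩ : ∃ η : E, η = M⁻¹ • (v - y₁) := ⟨_, rfl⟩
    have hηv : M • η = v - y₁ := by
      rw [hη, smul_smul, mul_inv_cancel₀ (by linarith), one_smul]
    have e1 : v - M • η = y₁ := by rw [hηv]; abel
    have hyz : v + η - z = ((1 + M) / M) • (v - (z + (1 + M)⁻¹ • (y₁ - z))) := by
      have h1 : ((1 + M) / M) • (v - (z + (1 + M)⁻¹ • (y₁ - z)))
          = ((1 + M) / M) • (v - z) - M⁻¹ • (y₁ - z) := by
        rw [← sub_sub, smul_sub, smul_smul]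
        congr 2
        field_simp
      have h2 : (1 + M) / M = M⁻¹ + 1 := by field_simp
      rw [h1, h2, add_smul, one_smul, hη, ← sub_add_eq_add_sub]
      have : v - y₁ = (v - z) - (y₁ - z) := by abel
      rw [this, smul_sub]
      abel
    have hyz' : ‖v + η - z‖ ≤ r / 64 := by
      rw [hyz, norm_smul, Real.norm_of_nonneg (by positivity)]
      have : (1 + M) / M ≤ 2 := by rw [div_le_iff₀ (by linarith)]; linarith
      calc (1 + M) / M * ‖v - (z + (1 + M)⁻¹ • (y₁ - z))‖ ≤ 2 * (r / 128) := by gcongr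
        _ = r / 64 := by ring
    have hy1 : ‖v + η‖ ≤ 1 := by
      have := norm_add_le (v + η - z) z
      rw [sub_add_cancel] at this
      linarith
    have hv1 : ‖v‖ ≤ 1 := by
      rw [← mem_closedBall_zero_iff]
      have : v = (M / (1 + M)) • (v + η) + (1 / (1 + M)) • y₁ := by
        rw [← e1]
        match_scalars <;> field_simp
        all_goals ring
      rw [this]
      exact convex_closedBall (0 : E) 1 (mem_closedBall_zero_iff.2 hy1) hy₁ (by positivity)
        (by positivity) (by field_simp; ring)
    obtain ⟨x, hx⟩ := exists_touchesAt hu ((1 + M) * a) v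
    refine ⟨x, ⟨⟨v, mem_closedBall_zero_iff.2 hv1, hx⟩, ?_⟩, hv1, hx⟩
    rw [mem_ball_iff_norm]
    by_contra! hfar
    have p1 := add_paraboloid_eq a M v η x
    have p2 := add_paraboloid_eq a M v η z
    rw [e1] at p1 p2
    have q1 := hx.2 z (mem_closedBall_zero_iff.2 (by linarith))
    have q2 := hqy.2 x hx.1
    have hxy : 3 * r / 64 ≤ ‖x - (v + η)‖ := by
      have t1 : x - x₁ = (x - (v + η)) + (v + η - z) + (z - x₁) := by abel
      have t2 := norm_add₃_le (a := x - (v + η)) (b := v + η - z) (c := z - x₁)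
      rw [← t1] at t2
      linarith
    have s1 : M * a / 2 * (3 * r / 64) ^ 2 ≤ M * a / 2 * ‖x - (v + η)‖ ^ 2 := by gcongr
    have s2 : M * a / 2 * ‖z - (v + η)‖ ^ 2 ≤ M * a / 2 * (r / 64) ^ 2 := by
      rw [norm_sub_rev]; gcongr
    -- `M = 2048 B` makes the gap between radii `3r/64` and `r/64` worth twice the excess `B a r²`;
    -- also `3r/64 + r/64 + r/16 = r/8`.
    have s3 : M * a / 2 * (3 * r / 64) ^ 2 = M * a / 2 * (r / 64) ^ 2 + 2 * (B * a * r ^ 2) := by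
      rw [hMB]; ring
    have s4 : 0 < B * a * r ^ 2 := by positivity
    linarith
  · rintro z₁ ⟨-, hz₁⟩ z₂ - v₁ v₂ ⟨hv₁, ht₁⟩ ⟨hv₂, ht₂⟩ hdist
    rw [Real.coe_toNNReal _ (by positivity), dist_eq_norm, dist_eq_norm]
    rw [dist_eq_norm] at hdist
    have hz₁n : ‖z₁‖ ≤ 1 / 4 := by
      rw [mem_ball_iff_norm] at hz₁
      have := norm_add_le (z₁ - x₁) x₁
      rw [sub_add_cancel] at this
      linarith
    have hMa : σ ≤ (1 + M) * a := hσ.trans (le_mul_of_one_le_left ha.le (by linarith))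
    have key := fun t ht => norm_sub_le_of_touchesAt (r := t) hlam hN hb₀ hD
      (by positivity : 0 < (1 + M) * a) hMa hρ2 hu hsup hz₁n hv₁ ht₁ ht₂ ht
    rcases (norm_nonneg (z₁ - z₂)).lt_or_eq with h | h
    · refine key _ h ?_ le_rfl
      rw [le_div_iff₀ (by positivity)] at hdist
      linarith
    -- `norm_sub_le_of_touchesAt` requires a positive radius, so for coinciding contact points it is
    -- applied with one small enough to give half the distance of the vertices.
    · rw [← h, mul_zero]
      by_contra! hpos
      have k1 := key (min (1 / (16 * D)) (‖v₁ - v₂‖ / (64 * D))) (by positivity) (by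
        calc 16 * D * min (1 / (16 * D)) (‖v₁ - v₂‖ / (64 * D)) ≤ 16 * D * (1 / (16 * D)) := by
              gcongr; exact min_le_left _ _
          _ = 1 := by field_simp) (by rw [← h]; positivity)
      have k2 : 32 * D * min (1 / (16 * D)) (‖v₁ - v₂‖ / (64 * D)) ≤ ‖v₁ - v₂‖ / 2 := by
        calc 32 * D * min (1 / (16 * D)) (‖v₁ - v₂‖ / (64 * D))
            ≤ 32 * D * (‖v₁ - v₂‖ / (64 * D)) := by gcongr; exact min_le_right _ _
          _ = ‖v₁ - v₂‖ / 2 := by field_simp; norm_num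
      linarith

end Growth

/-! ### Decay of the non-contact set and of the oscillation. -/

section Oscillation

variable {E : Type*} [NormedAddCommGroup E] [InnerProductSpace ℝ E] [FiniteDimensional ℝ E]
  [MeasurableSpace E] [BorelSpace E]

/-- The inverse of the portion of the complement of the contact set that is covered when the
opening is multiplied by `1 + openingFactor D`. -/
def coveringConst (d : ℕ) (D : ℝ) : ℝ :=
  160 ^ d * (32 * D) ^ d

/-- Take `r` to be the distance from `x` to the contact set in the closed quarter ball. Any part of
the larger contact set within `r / 4` of `x` and inside the quarter ball is then new. -/
lemma measure_ball_diff_contactSet_le {lam N b₀ ρ σ a D : ℝ} {u : E → ℝ}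
    (hlam : 0 < lam) (hN : 0 ≤ N) (hb₀ : 0 ≤ b₀) (hD : lam * D = lam + N + 2 * b₀ + 1)
    (ha : 0 < a) (hσ : σ ≤ a) (hρ : 2010 * (D + 1) * (1 + openingFactor D) * a ≤ ρ)
    (hu : ContinuousOn u (closedBall 0 1)) (hsup : IsQuadSuper lam N b₀ ρ σ (ball 0 1) u)
    (hne : (contactSet u a ∩ closedBall 0 (1 / 4)).Nonempty) :
    μH[finrank ℝ E] (ball (0 : E) (1 / 4) \ contactSet u a) ≤
      ENNReal.ofReal (coveringConst (finrank ℝ E) D) *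
        μH[finrank ℝ E] (ball (0 : E) (1 / 4) ∩
          (contactSet u ((1 + openingFactor D) * a) \ contactSet u a)) := by
  have hD1 : 1 ≤ D := by
    by_contra! h
    nlinarith
  have hcl : IsClosed (contactSet u a ∩ closedBall (0 : E) (1 / 4)) :=
    (isClosed_contactSet hu a).inter isClosed_closedBall
  refine measure_diff_le_of_forall_exists_piece _ (R := 1 / 2) fun x hx => ?_
  obtain ⟨q, hq, hqx⟩ := hcl.exists_infDist_eq_dist hne x
  obtain ⟨r, hr⟩ : ∃ r, r = dist x q := ⟨_, rfl⟩
  rw [← hr] at hqx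
  have hxn : ‖x‖ < 1 / 4 := mem_ball_zero_iff.1 hx.1
  have hqn : ‖q‖ ≤ 1 / 4 := mem_closedBall_zero_iff.1 hq.2
  have hr0 : 0 < r := by
    rw [hr]
    refine dist_pos.2 ?_
    rintro rfl
    exact hx.2 hq.1
  have hr2 : r ≤ 1 / 2 := by
    rw [hr, dist_eq_norm]
    linarith [norm_sub_le x q]
  -- The centre is pulled towards the origin, so that the ball of radius `r / 8` stays in the
  -- quarter ball and within `r / 4` of `x`.
  obtain ⟨x₁, hx₁⟩ : ∃ x₁ : E, x₁ = (1 - r / 2) • x := ⟨_, rfl⟩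
  have hx₁n : ‖x₁‖ + r / 8 ≤ 1 / 4 := by
    rw [hx₁, norm_smul, Real.norm_of_nonneg (by linarith)]
    nlinarith
  have hx₁x : ‖x - x₁‖ ≤ r / 8 := by
    have : x - x₁ = (r / 2) • x := by rw [hx₁]; module
    rw [this, norm_smul, Real.norm_of_nonneg (by linarith)]
    nlinarith
  have hball : ∀ z ∈ ball x₁ (r / 8), dist z x < r / 4 := by
    intro z hz
    rw [mem_ball] at hz
    have := dist_triangle z x₁ x
    rw [dist_comm x₁ x, dist_eq_norm x x₁] at this
    linarith
  have hball' : ball x₁ (r / 8) ⊆ ball (0 : E) (1 / 4) := by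
    intro z hz
    rw [mem_ball_iff_norm] at hz
    rw [mem_ball_zero_iff]
    have := norm_add_le (z - x₁) x₁
    rw [sub_add_cancel] at this
    linarith
  refine ⟨r, hr0, hr2, contactSet u ((1 + openingFactor D) * a) ∩ ball x₁ (r / 8),
    (isClosed_contactSet hu _).measurableSet.inter measurableSet_ball, ?_, ?_, ?_⟩
  · rintro z ⟨hz1, hz2⟩
    refine ⟨hball' hz2, hz1, fun hz3 => ?_⟩
    have h1 := infDist_le_dist_of_mem (x := x) (s := contactSet u a ∩ closedBall (0 : E) (1 / 4))
      ⟨hz3, ball_subset_closedBall (hball' hz2)⟩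
    have h2 := hball z hz2
    rw [dist_comm] at h2
    linarith
  · rintro z ⟨-, hz⟩
    exact (hball z hz).le
  · have h1 := Measure.addHaar_closedBall_mul (μ := (μH[finrank ℝ E] : Measure E)) x
      (r := 160) (by norm_num) (s := r / 128) (by positivity)
    rw [show 160 * (r / 128) = 5 / 4 * r by ring] at h1
    have hqx₁ : ‖q - x₁‖ ≤ 9 / 8 * r := by
      have h2 : q - x₁ = (q - x) + (x - x₁) := by abel
      have h3 := norm_add_le (q - x) (x - x₁)
      rw [← h2, ← dist_eq_norm q x, dist_comm, ← hr] at h3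
      linarith
    rw [h1, coveringConst, ENNReal.ofReal_mul (by positivity), mul_assoc]
    gcongr
    have h4 := measure_closedBall_le_measure_contactSet hlam hN hb₀ hD ha hσ hρ hu hsup hq.1 hr0
      hr2 hx₁n hqx₁ 0
    rwa [ENNReal.rpow_natCast, ← ENNReal.ofReal, ← ENNReal.ofReal_pow (by positivity)] at h4

lemma one_le_coveringConst {d : ℕ} {D : ℝ} (hD : 1 ≤ D) : 1 ≤ coveringConst d D :=
  one_le_mul_of_one_le_of_one_le (one_le_pow₀ (by norm_num)) (one_le_pow₀ (by linarith))

/-- The non-contact part loses the fraction `1 / coveringConst` at each step. Nonemptiness is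
carried along because the next step needs a contact point to start from. -/
lemma measureReal_ball_diff_contactSet_le {lam N b₀ ρ σ a D : ℝ} {u : E → ℝ}
    (hlam : 0 < lam) (hN : 0 ≤ N) (hb₀ : 0 ≤ b₀) (hD : lam * D = lam + N + 2 * b₀ + 1)
    (ha : 0 < a) (hσ : σ ≤ a) (hu : ContinuousOn u (closedBall 0 1))
    (hsup : IsQuadSuper lam N b₀ ρ σ (ball 0 1) u)
    (hne : (contactSet u a ∩ closedBall 0 (1 / 4)).Nonempty) (k : ℕ)
    (hρ : 2010 * (D + 1) * ((1 + openingFactor D) ^ k * a) ≤ ρ) :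
    (μH[finrank ℝ E]).real (ball (0 : E) (1 / 4) \ contactSet u ((1 + openingFactor D) ^ k * a)) ≤
      (1 - (coveringConst (finrank ℝ E) D)⁻¹) ^ k *
        (μH[finrank ℝ E]).real (ball (0 : E) (1 / 4)) ∧
    (contactSet u ((1 + openingFactor D) ^ k * a) ∩ closedBall 0 (1 / 4)).Nonempty := by
  have hD1 : 1 ≤ D := by
    by_contra! h
    nlinarith
  have hM : 0 ≤ openingFactor D := by
    have := one_le_barrierConst hD1
    rw [openingFactor]
    linarith
  have hC := one_le_coveringConst (d := finrank ℝ E) hD1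
  induction k with
  | zero =>
    simp only [pow_zero, one_mul]
    exact ⟨measureReal_mono sdiff_subset measure_ball_lt_top.ne, hne⟩
  | succ k ih =>
    obtain ⟨b, hb⟩ : ∃ b, b = (1 + openingFactor D) ^ k * a := ⟨_, rfl⟩
    have hb0 : 0 < b := by rw [hb]; positivity
    have hab : a ≤ b := by
      rw [hb]
      exact le_mul_of_one_le_left ha.le (one_le_pow₀ (by linarith))
    have hs : (1 + openingFactor D) ^ (k + 1) * a = (1 + openingFactor D) * b := by
      rw [hb, pow_succ]; ring
    rw [hs] at hρ ⊢
    rw [← hb] at ih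
    have hmono := contactSet_mono (u := u) hb0 hM
    obtain ⟨ih1, ih2⟩ := ih (le_trans (by gcongr; exact le_mul_of_one_le_left hb0.le (by linarith))
      hρ)
    refine ⟨?_, ih2.mono (inter_subset_inter_left _ hmono)⟩
    have h1 := measure_ball_diff_contactSet_le hlam hN hb₀ hD hb0 (hσ.trans hab)
      (by rwa [mul_assoc (2010 * (D + 1))]) hu hsup ih2
    have hfin : ∀ S ⊆ ball (0 : E) (1 / 4), μH[finrank ℝ E] S ≠ ∞ := fun S hS =>
      measure_ne_top_of_subset hS measure_ball_lt_top.ne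
    have h2 : (μH[finrank ℝ E]).real (ball (0 : E) (1 / 4) \ contactSet u b) ≤
        coveringConst (finrank ℝ E) D * (μH[finrank ℝ E]).real (ball (0 : E) (1 / 4) ∩
          (contactSet u ((1 + openingFactor D) * b) \ contactSet u b)) := by
      have h3 := ENNReal.toReal_mono
        (ENNReal.mul_ne_top ENNReal.ofReal_ne_top (hfin _ inter_subset_left)) h1
      rwa [ENNReal.toReal_mul, ENNReal.toReal_ofReal (by linarith)] at h3
    have h4 : (μH[finrank ℝ E]).real (ball (0 : E) (1 / 4) ∩
          (contactSet u ((1 + openingFactor D) * b) \ contactSet u b))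
        + (μH[finrank ℝ E]).real
          (ball (0 : E) (1 / 4) \ contactSet u ((1 + openingFactor D) * b))
        = (μH[finrank ℝ E]).real (ball (0 : E) (1 / 4) \ contactSet u b) := by
      rw [← measureReal_inter_add_sdiff (s := ball (0 : E) (1 / 4) \ contactSet u b)
        (isClosed_contactSet hu ((1 + openingFactor D) * b)).measurableSet (hfin _ sdiff_subset)]
      congr 2
      · ext z; simp only [mem_inter_iff, Set.mem_sdiff]; tauto
      · rw [Set.sdiff_sdiff, union_eq_self_of_subset_left hmono]
    have h5 : (coveringConst (finrank ℝ E) D)⁻¹ *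
        (μH[finrank ℝ E]).real (ball (0 : E) (1 / 4) \ contactSet u b) ≤
          (μH[finrank ℝ E]).real (ball (0 : E) (1 / 4) ∩
          (contactSet u ((1 + openingFactor D) * b) \ contactSet u b)) := by
      rw [inv_mul_le_iff₀ (by linarith)]
      exact h2
    have h6 : 0 ≤ 1 - (coveringConst (finrank ℝ E) D)⁻¹ := by
      rw [sub_nonneg]
      exact inv_le_one_of_one_le₀ hC
    calc _ ≤ (1 - (coveringConst (finrank ℝ E) D)⁻¹) *
        (μH[finrank ℝ E]).real (ball (0 : E) (1 / 4) \ contactSet u b) := by linarith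
      _ ≤ (1 - (coveringConst (finrank ℝ E) D)⁻¹) *
          ((1 - (coveringConst (finrank ℝ E) D)⁻¹) ^ k *
            (μH[finrank ℝ E]).real (ball (0 : E) (1 / 4))) := by gcongr
      _ = _ := by rw [pow_succ]; ring

variable (E) in
/-- A supersolution that is small somewhere near the centre is less than `1 / 2` on more than half
of a ball. -/
lemma exists_measureReal_lt {lam N b₀ : ℝ} (hlam : 0 < lam) (hN : 0 ≤ N) (hb₀ : 0 ≤ b₀) :
    ∃ ε σ ρ : ℝ, 0 < ε ∧ ε ≤ 1 / 2 ∧ 0 < σ ∧ σ < 1 ∧ 1 ≤ ρ ∧ ∀ u : E → ℝ,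
      ContinuousOn u (closedBall 0 1) → (∀ x ∈ closedBall 0 1, 0 ≤ u x) →
      IsQuadSuper lam N b₀ ρ σ (ball 0 1) u → (∃ x ∈ closedBall 0 (1 / 8), u x < ε) →
      (μH[finrank ℝ E]).real {x ∈ ball (0 : E) (1 / 4) | 1 / 2 ≤ u x} <
        (μH[finrank ℝ E]).real (ball (0 : E) (1 / 4)) / 2 := by
  obtain ⟨D, hD⟩ : ∃ D, lam * D = lam + N + 2 * b₀ + 1 :=
    ⟨(lam + N + 2 * b₀ + 1) / lam, by field_simp⟩
  have hD1 : 1 ≤ D := by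
    by_contra! h
    nlinarith
  have hM : 0 ≤ openingFactor D := by
    have := one_le_barrierConst hD1
    rw [openingFactor]
    linarith
  have hC := one_le_coveringConst (d := finrank ℝ E) hD1
  have hθ : 1 - (coveringConst (finrank ℝ E) D)⁻¹ < 1 := by
    have : 0 < (coveringConst (finrank ℝ E) D)⁻¹ := by positivity
    linarith
  obtain ⟨k, hk⟩ := exists_pow_lt_of_lt_one (by norm_num : (0 : ℝ) < 1 / 2) hθ
  obtain ⟨T, hT⟩ : ∃ T, T = (1 + openingFactor D) ^ k := ⟨_, rfl⟩
  have hT1 : 1 ≤ T := by rw [hT]; exact one_le_pow₀ (by linarith)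
  -- The initial opening is such that after `k` steps it is `1/8`; contact with such a paraboloid
  -- still forces `u < 1/2`.
  obtain ⟨a, ha⟩ : ∃ a, a = 1 / (8 * T) := ⟨_, rfl⟩
  have ha0 : 0 < a := by rw [ha]; positivity
  have hTa : T * a = 1 / 8 := by rw [ha]; field_simp
  have ha1 : a ≤ 1 / 8 := by rw [← hTa]; exact le_mul_of_one_le_left ha0.le hT1
  refine ⟨a / 64, a, 2010 * (D + 1), by positivity, by linarith, ha0, by linarith, by linarith,
    ?_⟩
  rintro u hu hu0 hsup ⟨x', hx', hux'⟩
  rw [mem_closedBall_zero_iff] at hx'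
  -- With vertex `0`, the value at `x'` is below `a/64 + a/128`, while outside the quarter ball it
  -- would exceed `a/32`.
  have hne : (contactSet u a ∩ closedBall 0 (1 / 4)).Nonempty := by
    obtain ⟨x, hx⟩ := exists_touchesAt hu a 0
    refine ⟨x, ⟨0, by simp, hx⟩, ?_⟩
    rw [mem_closedBall_zero_iff]
    by_contra! hfar
    have h1 := hx.2 x' (mem_closedBall_zero_iff.2 (by linarith))
    have h2 := hu0 x hx.1
    rw [sub_zero, sub_zero] at h1
    have h3 : a / 2 * ‖x'‖ ^ 2 ≤ a / 2 * (1 / 8) ^ 2 := by gcongr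
    have h4 : a / 2 * (1 / 4) ^ 2 ≤ a / 2 * ‖x‖ ^ 2 := by gcongr
    linarith
  have h := (measureReal_ball_diff_contactSet_le hlam hN hb₀ hD ha0 le_rfl hu hsup hne k (by
    rw [← hT, hTa]; linarith)).1
  rw [← hT, hTa] at h
  have hpos : 0 < (μH[finrank ℝ E]).real (ball (0 : E) (1 / 4)) :=
    ENNReal.toReal_pos (measure_ball_pos _ _ (by norm_num)).ne' measure_ball_lt_top.ne
  calc (μH[finrank ℝ E]).real {x ∈ ball (0 : E) (1 / 4) | 1 / 2 ≤ u x}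
      ≤ (μH[finrank ℝ E]).real (ball (0 : E) (1 / 4) \ contactSet u (1 / 8)) := by
        refine measureReal_mono ?_ (measure_ne_top_of_subset sdiff_subset measure_ball_lt_top.ne)
        rintro x ⟨hx, hxu⟩
        refine ⟨hx, ?_⟩
        rintro ⟨y, hy, -, hxy⟩
        have h1 := hxy x' (mem_closedBall_zero_iff.2 (by linarith))
        have h2 := norm_sub_le x' y
        rw [mem_closedBall_zero_iff] at hy
        have h3 : ‖x' - y‖ ^ 2 ≤ (9 / 8) ^ 2 := by gcongr; linarith
        have h4 : 0 ≤ ‖x - y‖ ^ 2 := by positivity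
        linarith
    _ ≤ _ := h
    _ < 1 / 2 * (μH[finrank ℝ E]).real (ball (0 : E) (1 / 4)) := by gcongr
    _ = _ := by ring

variable (E) in
/-- Decay of the oscillation from the unit ball to the ball of radius `1 / 8`. -/
lemma exists_oscillation_decay {lam N b₀ : ℝ} (hlam : 0 < lam) (hN : 0 ≤ N) (hb₀ : 0 ≤ b₀) :
    ∃ ε σ ρ : ℝ, 0 < ε ∧ ε ≤ 1 / 2 ∧ 0 < σ ∧ σ < 1 ∧ 1 ≤ ρ ∧ ∀ u : E → ℝ,
      ContinuousOn u (closedBall 0 1) → (∀ x ∈ closedBall 0 1, 0 ≤ u x ∧ u x ≤ 1) →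
      IsQuadSuper lam N b₀ ρ σ (ball 0 1) u →
      IsQuadSuper lam N b₀ ρ σ (ball 0 1) (fun x => 1 - u x) →
      (∀ x ∈ closedBall 0 (1 / 8), ε ≤ u x) ∨ (∀ x ∈ closedBall 0 (1 / 8), u x ≤ 1 - ε) := by
  obtain ⟨ε, σ, ρ, hε, hε2, hσ, hσ1, hρ, h⟩ := exists_measureReal_lt E hlam hN hb₀
  refine ⟨ε, σ, ρ, hε, hε2, hσ, hσ1, hρ, fun u hu hu01 hs₁ hs₂ => ?_⟩
  by_contra! hcon
  obtain ⟨⟨x₁, hx₁, hux₁⟩, x₂, hx₂, hux₂⟩ := hcon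
  have h1 := h u hu (fun x hx => (hu01 x hx).1) hs₁ ⟨x₁, hx₁, hux₁⟩
  have h2 := h (fun x => 1 - u x) (by fun_prop) (fun x hx => by linarith [(hu01 x hx).2]) hs₂
    ⟨x₂, hx₂, by linarith⟩
  have h3 : (μH[finrank ℝ E]).real (ball (0 : E) (1 / 4)) ≤
      (μH[finrank ℝ E]).real ({x ∈ ball (0 : E) (1 / 4) | 1 / 2 ≤ u x} ∪
        {x ∈ ball (0 : E) (1 / 4) | 1 / 2 ≤ 1 - u x}) := by
    refine measureReal_mono ?_ (measure_ne_top_of_subset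
      (union_subset (sep_subset _ _) (sep_subset _ _)) measure_ball_lt_top.ne)
    intro x hx
    rcases le_total (1 / 2) (u x) with h | h
    · exact Or.inl ⟨hx, h⟩
    · exact Or.inr ⟨hx, by linarith⟩
  have h4 := measureReal_union_le (μ := (μH[finrank ℝ E] : Measure E))
    {x ∈ ball (0 : E) (1 / 4) | 1 / 2 ≤ u x} {x ∈ ball (0 : E) (1 / 4) | 1 / 2 ≤ 1 - u x}
  linarith

end Oscillation

/-! ### Rescaling. -/

section Scaling

variable {E : Type*} [NormedAddCommGroup E] [InnerProductSpace ℝ E]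

/-- Undoing the scaling multiplies Hessians by `t = ω / r² ≥ 1` and gradients by `t r ≤ t`. The
drift thus only becomes weaker, the right-hand side `σ` may be kept, and a test of size `ρ'` becomes
one of size at most `t ρ' ≤ ρ`. -/
lemma IsQuadSuper.rescale {lam N b₀ ρ ρ' σ : ℝ} {u : E → ℝ} (hb₀ : 0 ≤ b₀) (hσ : 0 ≤ σ)
    (hsup : IsQuadSuper lam N b₀ ρ σ (ball 0 1) u) {x₀ : E} {r ω : ℝ} (m : ℝ) (hr : 0 < r)
    (hr1 : r ≤ 1) (hω : 0 < ω) (hrω : r ^ 2 ≤ ω) (hρ : ρ' * ω ≤ ρ * r ^ 2)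
    (hball : ball x₀ r ⊆ ball 0 1) :
    IsQuadSuper lam N b₀ ρ' σ (ball 0 1) (fun x => (u (x₀ + r • x) - m) / ω) := by
  intro x hx e p κ K he hκ hK hKκ hp htouch
  obtain ⟨t, ht⟩ : ∃ t, t = ω / r ^ 2 := ⟨_, rfl⟩
  have hωt : ω = t * r ^ 2 := by rw [ht]; field_simp
  have ht1 : 1 ≤ t := by rw [ht, le_div_iff₀ (by positivity)]; linarith
  have htρ : t * ρ' ≤ ρ := by
    rw [ht, div_mul_eq_mul_div, div_le_iff₀ (by positivity)]; linarith
  have hxb : x₀ + r • x ∈ ball (0 : E) 1 := by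
    apply hball
    rw [mem_ball_iff_norm, add_sub_cancel_left, norm_smul, Real.norm_of_nonneg hr.le]
    exact mul_lt_of_lt_one_right hr (mem_ball_zero_iff.1 hx)
  have hpn : ‖(t * r) • p‖ = t * r * ‖p‖ := by
    rw [norm_smul, Real.norm_of_nonneg (by positivity)]
  have hpt : t * r * ‖p‖ ≤ t * ‖p‖ := by
    gcongr
    exact mul_le_of_le_one_right (by linarith) hr1
  have hfin := hsup _ hxb e ((t * r) • p) (t * κ) (t * K) he (by positivity) (by positivity)
    (by
      have : t * (K + 2 * κ) ≤ t * ρ' := by gcongr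
      linarith)
    (by
      have : t * ‖p‖ ≤ t * ρ' := by gcongr
      linarith)
    (by
      have hc : Tendsto (fun h : E => r⁻¹ • h) (𝓝 0) (𝓝 0) := by
        have : Continuous fun h : E => r⁻¹ • h := by fun_prop
        simpa using this.tendsto 0
      filter_upwards [hc.eventually htouch] with h hh
      have e1 : x₀ + r • (x + r⁻¹ • h) = x₀ + r • x + h := by
        rw [smul_add, smul_smul, mul_inv_cancel₀ hr.ne', one_smul, add_assoc]
      rw [e1, le_div_iff₀ hω, inner_smul_right, inner_smul_right, norm_smul, norm_inv,
        Real.norm_of_nonneg hr.le] at hh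
      rw [real_inner_smul_left]
      have e2 : ((u (x₀ + r • x) - m) / ω + r⁻¹ * ⟪p, h⟫ +
          ((K + κ) * (r⁻¹ * ⟪e, h⟫) ^ 2 - κ * (r⁻¹ * ‖h‖) ^ 2) / 2) * ω =
          u (x₀ + r • x) - m + t * r * ⟪p, h⟫ +
            ((t * K + t * κ) * ⟪e, h⟫ ^ 2 - t * κ * ‖h‖ ^ 2) / 2 := by
        rw [add_mul, add_mul, div_mul_cancel₀ _ hω.ne', hωt]
        field_simp
      linarith)
  rw [hpn] at hfin
  by_contra! hcon
  have h1 : b₀ * (t * r * ‖p‖) ≤ b₀ * (t * ‖p‖) := by gcongr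
  have h2 : 1 * (lam * K - N * κ - b₀ * ‖p‖) ≤ t * (lam * K - N * κ - b₀ * ‖p‖) := by
    gcongr
    linarith
  linarith

end Scaling

/-! ### From oscillation decay to a Hölder estimate. -/

section Iteration

variable {E : Type*} [NormedAddCommGroup E] [InnerProductSpace ℝ E] [FiniteDimensional ℝ E]
  [MeasurableSpace E] [BorelSpace E]

variable (E) in
/-- Hölder continuity at scales `r` with `16 ≤ ρ r²`. -/
lemma exists_holder_estimate {lam N b₀ : ℝ} (hlam : 0 < lam) (hN : 0 ≤ N) (hb₀ : 0 ≤ b₀) :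
    ∃ σ C α : ℝ, 0 < σ ∧ σ < 1 ∧ 0 < C ∧ 1 ≤ C * (1 / 2) ^ α ∧ 0 < α ∧ α < 1 ∧
      ∀ (ρ : ℝ) (u : E → ℝ), ContinuousOn u (ball 0 1) →
        (∀ x ∈ ball 0 1, 0 ≤ u x ∧ u x ≤ 1) →
        IsQuadSuper lam N b₀ ρ σ (ball 0 1) u →
        IsQuadSuper lam N b₀ ρ σ (ball 0 1) (fun x => 1 - u x) →
        ∀ x₀ : E, ‖x₀‖ ≤ 1 / 2 → ∀ r, 0 < r → 16 ≤ ρ * r ^ 2 →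
          ∀ x ∈ closedBall x₀ r ∩ ball 0 1, ∀ y ∈ closedBall x₀ r ∩ ball 0 1,
            |u x - u y| ≤ C * r ^ α := by
  obtain ⟨ε, σ, S, hε, hε2, hσ, hσ1, hS, hdecay⟩ := exists_oscillation_decay E hlam hN hb₀
  obtain ⟨θ, hθ⟩ : ∃ θ, θ = 1 - ε := ⟨_, rfl⟩
  have hθ0 : 0 < θ := by linarith
  have hθ1 : θ < 1 := by linarith
  -- The exponent matches a factor `θ` of oscillation to a factor `1/8` of radius; `θ ≥ 1/2 > 1/8`
  -- gives `α < 1`.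
  obtain ⟨α, hα⟩ : ∃ α, α = Real.logb (1 / 8) θ := ⟨_, rfl⟩
  have hαθ : (1 / 8 : ℝ) ^ α = θ := by
    rw [hα, Real.rpow_logb (by norm_num) (by norm_num) hθ0]
  have hα0 : 0 < α := by
    rw [hα]
    exact Real.logb_pos_of_base_lt_one (by norm_num) (by norm_num) hθ0 hθ1
  have hα1 : α < 1 := by
    by_contra! h
    have := Real.rpow_le_rpow_of_exponent_ge (by norm_num : (0 : ℝ) < 1 / 8) (by norm_num) h
    rw [hαθ, Real.rpow_one] at this
    linarith
  refine ⟨σ, (32 * S) ^ α, α, hσ, hσ1, by positivity, ?_, hα0, hα1, ?_⟩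
  · rw [← Real.mul_rpow (by positivity) (by norm_num)]
    exact Real.one_le_rpow (by linarith) hα0.le
  intro ρ u hu hu01 hs₁ hs₂ x₀ hx₀ r hr hρr
  -- Starting at radius `1/4` keeps every ball inside the unit ball, as `‖x₀‖ ≤ 1/2`.
  have hiter : ∀ j : ℕ, (∀ i < j, S ≤ ρ * (1 / 4 * (1 / 8) ^ i) ^ 2) →
      ∃ m, ∀ x ∈ closedBall x₀ (1 / 4 * (1 / 8) ^ j), m ≤ u x ∧ u x ≤ m + θ ^ j := by
    intro j
    induction j with
    | zero =>
      refine fun _ => ⟨0, fun x hx => ?_⟩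
      have h1 : x ∈ ball (0 : E) 1 := by
        rw [mem_ball_zero_iff]
        rw [mem_closedBall_iff_norm, pow_zero] at hx
        have := norm_add_le (x - x₀) x₀
        rw [sub_add_cancel] at this
        linarith
      simpa using hu01 x h1
    | succ j ih =>
      intro hj
      obtain ⟨m, hm⟩ := ih fun i hi => hj i (by omega)
      have hSj := hj j (by omega)
      obtain ⟨R, hR⟩ : ∃ R : ℝ, R = 1 / 4 * (1 / 8) ^ j := ⟨_, rfl⟩
      obtain ⟨ω, hω⟩ : ∃ ω, ω = θ ^ j := ⟨_, rfl⟩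
      have hω0 : 0 < ω := by rw [hω]; positivity
      have hω1 : ω ≤ 1 := by rw [hω]; exact pow_le_one₀ hθ0.le hθ1.le
      rw [← hR] at hm hSj
      rw [← hω] at hm
      have hR0 : 0 < R := by rw [hR]; positivity
      have hR4 : R ≤ 1 / 4 := by
        rw [hR]
        exact mul_le_of_le_one_right (by norm_num) (pow_le_one₀ (by norm_num) (by norm_num))
      have hRω : R ^ 2 ≤ ω := by
        calc R ^ 2 ≤ R := by nlinarith
          _ ≤ 1 * (1 / 8) ^ j := by rw [hR]; gcongr; norm_num
          _ ≤ ω := by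
            rw [one_mul, hω]
            exact pow_le_pow_left₀ (by norm_num) (by linarith) j
      have hcb : closedBall x₀ R ⊆ ball (0 : E) 1 := by
        intro x hx
        rw [mem_ball_zero_iff]
        rw [mem_closedBall_iff_norm] at hx
        have := norm_add_le (x - x₀) x₀
        rw [sub_add_cancel] at this
        linarith
      have hSω : S * ω ≤ ρ * R ^ 2 := by
        refine le_trans ?_ hSj
        exact mul_le_of_le_one_right (by linarith) hω1
      have hmaps : ∀ x ∈ closedBall (0 : E) 1, x₀ + R • x ∈ closedBall x₀ R := by
        intro x hx
        rw [mem_closedBall_iff_norm, add_sub_cancel_left, norm_smul, Real.norm_of_nonneg hR0.le]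
        exact mul_le_of_le_one_right hR0.le (mem_closedBall_zero_iff.1 hx)
      have hbb := ball_subset_closedBall.trans hcb
      have k1 := hs₁.rescale hb₀ hσ.le m hR0 (by linarith) hω0 hRω hSω hbb
      -- The shift `1 - m - ω` makes the rescaling of `1 - u` equal to one minus the rescaling of
      -- `u`.
      have k2 := hs₂.rescale hb₀ hσ.le (1 - m - ω) hR0 (by linarith) hω0 hRω hSω hbb
      have hcont : ContinuousOn (fun x => (u (x₀ + R • x) - m) / ω) (closedBall 0 1) := by
        refine ContinuousOn.div_const (ContinuousOn.sub ?_ continuousOn_const) _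
        exact (hu.mono hcb).comp (by fun_prop) hmaps
      have key := hdecay _ hcont (fun x hx => by
          have := hm _ (hmaps x hx)
          rw [le_div_iff₀ hω0, div_le_iff₀ hω0]
          constructor <;> linarith) k1 (by
          convert k2 using 2 with x
          field_simp
          ring)
      have hback : ∀ x ∈ closedBall x₀ (1 / 4 * (1 / 8) ^ (j + 1)),
          R⁻¹ • (x - x₀) ∈ closedBall (0 : E) (1 / 8) ∧ x₀ + R • (R⁻¹ • (x - x₀)) = x ∧
            x ∈ closedBall x₀ R := by
        intro x hx
        rw [mem_closedBall_iff_norm, pow_succ, ← mul_assoc, ← hR] at hx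
        refine ⟨?_, ?_, ?_⟩
        · rw [mem_closedBall_zero_iff, norm_smul, norm_inv, Real.norm_of_nonneg hR0.le,
            inv_mul_le_iff₀ hR0]
          exact hx
        · rw [smul_smul, mul_inv_cancel₀ hR0.ne', one_smul]; abel
        · rw [mem_closedBall_iff_norm]; linarith
      have hωs : θ ^ (j + 1) = ω - ω * ε := by rw [pow_succ, ← hω, hθ]; ring
      rw [hωs]
      rcases key with key | key
      · refine ⟨m + ω * ε, fun x hx => ?_⟩
        obtain ⟨b1, b2, b3⟩ := hback x hx
        have h1 := key _ b1
        rw [b2, le_div_iff₀ hω0] at h1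
        have h2 := hm x b3
        constructor <;> linarith
      · refine ⟨m, fun x hx => ?_⟩
        obtain ⟨b1, b2, b3⟩ := hback x hx
        have h1 := key _ b1
        rw [b2, div_le_iff₀ hω0] at h1
        have h2 := hm x b3
        constructor <;> linarith
  rintro x ⟨hx, hx1⟩ y ⟨hy, hy1⟩
  rw [← Real.mul_rpow (by positivity) hr.le]
  -- The last scale `j` is chosen by comparing `S r`, not `r`, with `1/4 (1/8)^j`. Then `ρ r² ≥ 16`
  -- already gives `ρ (S r)² ≥ S`, which permits all earlier steps. If `4 S r > 1`, the bound `|u x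
  -- - u y| ≤ 1` suffices.
  rcases le_or_gt (4 * S * r) 1 with hsmall | hbig
  · obtain ⟨j, hj1, hj2⟩ := exists_nat_pow_near_of_lt_one (by positivity : 0 < 4 * S * r) hsmall
      (by norm_num : (0 : ℝ) < 1 / 8) (by norm_num)
    have hrj : r ≤ 1 / 4 * (1 / 8) ^ j := by
      have : 1 * r ≤ S * r := by gcongr
      linarith
    obtain ⟨m, hm⟩ := hiter j fun i hi => by
      have h1 : (1 / 8 : ℝ) ^ j ≤ (1 / 8) ^ i :=
        pow_le_pow_of_le_one (by norm_num) (by norm_num) hi.le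
      have h2 : S * r ≤ 1 / 4 * (1 / 8) ^ i := by linarith
      have hρ0 : 0 ≤ ρ := by
        by_contra! h
        have : ρ * r ^ 2 ≤ 0 := mul_nonpos_of_nonpos_of_nonneg h.le (by positivity)
        linarith
      calc S ≤ S ^ 2 * 16 := by nlinarith
        _ ≤ S ^ 2 * (ρ * r ^ 2) := by gcongr
        _ = ρ * (S * r) ^ 2 := by ring
        _ ≤ ρ * (1 / 4 * (1 / 8) ^ i) ^ 2 := by gcongr
    have h1 := hm x (closedBall_subset_closedBall hrj hx)
    have h2 := hm y (closedBall_subset_closedBall hrj hy)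
    calc |u x - u y| ≤ θ ^ j := by rw [abs_le]; constructor <;> linarith
      _ = ((1 / 8 : ℝ) ^ j) ^ α := by
        rw [← hαθ, ← Real.rpow_natCast, ← Real.rpow_natCast, ← Real.rpow_mul (by norm_num),
          ← Real.rpow_mul (by norm_num), mul_comm]
      _ ≤ (32 * S * r) ^ α := by
        refine Real.rpow_le_rpow (by positivity) ?_ hα0.le
        rw [pow_succ] at hj1
        linarith
  · have h1 := hu01 x hx1
    have h2 := hu01 y hy1
    calc |u x - u y| ≤ 1 := by rw [abs_le]; constructor <;> linarith
      _ ≤ (32 * S * r) ^ α := Real.one_le_rpow (by linarith) hα0.le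

end Iteration

/-! ### Pucci operators on the quadratic tests. -/

section Pucci

open Polynomial in
-- The matrix is a scalar shift of a rank-one matrix, so its characteristic polynomial is a
-- translate of `X ^ (n - 1) * (X - A)`.
lemma roots_charpoly_rankOne {n : ℕ} (hn : 1 ≤ n) (A B : ℝ) (e : Fin n → ℝ) (he : e ⬝ᵥ e = 1) :
    (A • Matrix.vecMulVec e e - Matrix.scalar (Fin n) B).charpoly.roots =
      (A - B) ::ₘ Multiset.replicate (n - 1) (-B) := by
  have h1 : A • Matrix.vecMulVec e e = Matrix.vecMulVec (A • e) e := by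
    rw [Matrix.smul_vecMulVec]
  have h2 : (A • Matrix.vecMulVec e e - Matrix.scalar (Fin n) B).charpoly =
      (X - C (A - B)) * (X - C (-B)) ^ (n - 1) := by
    obtain ⟨k, rfl⟩ : ∃ k, n = k + 1 := ⟨n - 1, by omega⟩
    rw [Matrix.charpoly_sub_scalar, h1, Matrix.charpoly_vecMulVec, smul_dotProduct, he]
    simp only [Fintype.card_fin, smul_eq_mul, mul_one, Nat.add_sub_cancel, sub_comp, pow_comp,
      X_comp, mul_comp, C_comp, C_sub, C_neg, smul_eq_C_mul]
    ring
  rw [h2, roots_mul ((monic_X_sub_C _).mul ((monic_X_sub_C _).pow _)).ne_zero, roots_X_sub_C,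
    roots_pow, roots_X_sub_C, Multiset.nsmul_singleton, Multiset.singleton_add]

lemma sum_filter_pos_cons_replicate {K κ : ℝ} (hK : 0 ≤ K) (hκ : 0 ≤ κ) (m : ℕ) :
    ((K ::ₘ Multiset.replicate m (-κ)).filter (fun e => 0 < e)).sum = K := by
  have h : (Multiset.replicate m (-κ)).filter (fun e => 0 < e) = 0 :=
    Multiset.filter_eq_nil.2 fun x hx => by rw [Multiset.eq_of_mem_replicate hx]; linarith
  rcases hK.lt_or_eq with h0 | h0
  · rw [Multiset.filter_cons_of_pos _ h0, h]; simp
  · rw [Multiset.filter_cons_of_neg _ (by linarith), h]; simpa using h0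

lemma sum_filter_neg_cons_replicate {K κ : ℝ} (hK : 0 ≤ K) (hκ : 0 ≤ κ) (m : ℕ) :
    ((K ::ₘ Multiset.replicate m (-κ)).filter (fun e => e < 0)).sum = -(m * κ) := by
  rw [Multiset.filter_cons_of_neg _ (by linarith)]
  rcases hκ.lt_or_eq with h0 | h0
  · rw [Multiset.filter_eq_self.2 fun x hx => by rw [Multiset.eq_of_mem_replicate hx]; linarith]
    simp
  · rw [Multiset.filter_eq_nil.2 fun x hx => by rw [Multiset.eq_of_mem_replicate hx]; linarith]
    simp [← h0]

lemma sum_filter_pos_neg_cons_replicate {K κ : ℝ} (hK : 0 ≤ K) (hκ : 0 ≤ κ) (m : ℕ) :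
    ((-K ::ₘ Multiset.replicate m κ).filter (fun e => 0 < e)).sum = m * κ := by
  rw [Multiset.filter_cons_of_neg _ (by linarith)]
  rcases hκ.lt_or_eq with h0 | h0
  · rw [Multiset.filter_eq_self.2 fun x hx => by rw [Multiset.eq_of_mem_replicate hx]; linarith]
    simp
  · rw [Multiset.filter_eq_nil.2 fun x hx => by rw [Multiset.eq_of_mem_replicate hx]; linarith]
    simp [← h0]

lemma sum_filter_neg_neg_cons_replicate {K κ : ℝ} (hK : 0 ≤ K) (hκ : 0 ≤ κ) (m : ℕ) :
    ((-K ::ₘ Multiset.replicate m κ).filter (fun e => e < 0)).sum = -K := by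
  have h : (Multiset.replicate m κ).filter (fun e => e < 0) = 0 :=
    Multiset.filter_eq_nil.2 fun x hx => by rw [Multiset.eq_of_mem_replicate hx]; linarith
  rcases hK.lt_or_eq with h0 | h0
  · rw [Multiset.filter_cons_of_pos _ (by linarith), h]; simp
  · rw [Multiset.filter_cons_of_neg _ (by linarith), h]; simp [← h0]

/-- The quadratic polynomial with value `c`, gradient `p` and Hessian `A e ⊗ e - B` at `x₀`. -/
noncomputable def quadTest {E : Type*} [NormedAddCommGroup E] [InnerProductSpace ℝ E] (x₀ : E) (c : ℝ) (p e : E)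
    (A B : ℝ) (x : E) : ℝ :=
  c + ⟪p, x - x₀⟫ + (A * ⟪e, x - x₀⟫ ^ 2 - B * ‖x - x₀‖ ^ 2) / 2

variable {E : Type*} [NormedAddCommGroup E] [InnerProductSpace ℝ E]

variable (E) in
/-- The inner product as a bilinear map. -/
noncomputable def realInnerCLM : E →L[ℝ] E →L[ℝ] ℝ :=
  innerSL ℝ

@[simp]
lemma realInnerCLM_apply (v w : E) : realInnerCLM E v w = ⟪v, w⟫ :=
  rfl

lemma norm_realInnerCLM_apply (v : E) : ‖realInnerCLM E v‖ = ‖v‖ :=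
  innerSL_apply_norm ℝ v

lemma fderiv_quadTest (x₀ : E) (c : ℝ) (p e : E) (A B : ℝ) :
    fderiv ℝ (quadTest x₀ c p e A B) = fun x =>
      realInnerCLM E p + (A * ⟪e, x - x₀⟫) • realInnerCLM E e - B • realInnerCLM E (x - x₀) := by
  funext x
  have h0 : HasFDerivAt (fun x : E => x - x₀) (ContinuousLinearMap.id ℝ E) x :=
    (hasFDerivAt_id x).sub_const x₀
  have h1 : ∀ v : E, HasFDerivAt (fun x : E => ⟪v, x - x₀⟫) (realInnerCLM E v) x := fun v =>
    (realInnerCLM E v).hasFDerivAt.comp x h0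
  have h2 := h0.norm_sq
  have h3 := ((((h1 e).pow 2).const_mul A).sub (h2.const_mul B)).mul_const (1 / 2)
  have h4 := ((h1 p).const_add c).add h3
  have h5 : quadTest x₀ c p e A B = fun x => c + ⟪p, x - x₀⟫
      + (A * ⟪e, x - x₀⟫ ^ 2 - B * ‖x - x₀‖ ^ 2) * (1 / 2) := by
    funext x
    rw [quadTest]
    ring
  rw [h5]
  refine h4.fderiv.trans ?_
  ext v
  simp
  ring

lemma fderiv_fderiv_quadTest (x₀ : E) (c : ℝ) (p e : E) (A B : ℝ) (x : E) :
    fderiv ℝ (fderiv ℝ (quadTest x₀ c p e A B)) x =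
      A • (realInnerCLM E e).smulRight (realInnerCLM E e) - B • realInnerCLM E := by
  rw [fderiv_quadTest]
  have h0 : HasFDerivAt (fun x : E => x - x₀) (ContinuousLinearMap.id ℝ E) x :=
    (hasFDerivAt_id x).sub_const x₀
  have h1 : HasFDerivAt (fun x : E => A * ⟪e, x - x₀⟫) (A • realInnerCLM E e) x :=
    ((realInnerCLM E e).hasFDerivAt.comp x h0).const_mul A
  have h2 := (h1.smul_const (realInnerCLM E e)).const_add (realInnerCLM E p)
  have h3 : HasFDerivAt (fun x : E => B • realInnerCLM E (x - x₀)) (B • realInnerCLM E) x :=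
    ((realInnerCLM E).hasFDerivAt.comp x h0).const_smul B
  refine (h2.sub h3).fderiv.trans ?_
  ext v w
  simp [mul_assoc]

lemma contDiff_quadTest (x₀ : E) (c : ℝ) (p e : E) (A B : ℝ) :
    ContDiff ℝ 2 (quadTest x₀ c p e A B) := by
  have h0 : ContDiff ℝ 2 fun x : E => x - x₀ := by fun_prop
  have h1 : ∀ v : E, ContDiff ℝ 2 fun x : E => ⟪v, x - x₀⟫ := fun v => contDiff_const.inner ℝ h0
  exact (contDiff_const.add (h1 p)).add
    (((contDiff_const.mul ((h1 e).pow 2)).sub (contDiff_const.mul (h0.norm_sq ℝ))).div_const 2)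

lemma norm_fderiv_fderiv_quadTest_le (x₀ : E) (c : ℝ) (p : E) {e : E} (he : ‖e‖ = 1) (A B : ℝ)
    (x : E) : ‖fderiv ℝ (fderiv ℝ (quadTest x₀ c p e A B)) x‖ ≤ |A| + |B| := by
  rw [fderiv_fderiv_quadTest]
  refine ContinuousLinearMap.opNorm_le_bound₂ _ (by positivity) fun v w => ?_
  have h1 : ∀ z : E, |⟪e, z⟫| ≤ ‖z‖ := fun z => by
    simpa [he] using abs_real_inner_le_norm e z
  calc |A * (⟪e, v⟫ * ⟪e, w⟫) - B * ⟪v, w⟫|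
      ≤ |A| * (|⟪e, v⟫| * |⟪e, w⟫|) + |B| * |⟪v, w⟫| := by
        rw [← abs_mul, ← abs_mul, ← abs_mul]
        exact abs_sub _ _
    _ ≤ |A| * (‖v‖ * ‖w‖) + |B| * (‖v‖ * ‖w‖) := by
        gcongr
        · exact h1 v
        · exact h1 w
        · exact abs_real_inner_le_norm v w
    _ = (|A| + |B|) * ‖v‖ * ‖w‖ := by ring

lemma norm_fderiv_quadTest_self (x₀ : E) (c : ℝ) (p e : E) (A B : ℝ) :
    ‖fderiv ℝ (quadTest x₀ c p e A B) x₀‖ = ‖p‖ := by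
  rw [fderiv_quadTest]
  simp [norm_realInnerCLM_apply]

lemma hessianMatrix_quadTest {n : ℕ} (x₀ : EuclideanSpace ℝ (Fin n)) (c : ℝ)
    (p e : EuclideanSpace ℝ (Fin n)) (A B : ℝ) (x : EuclideanSpace ℝ (Fin n)) :
    hessianMatrix (quadTest x₀ c p e A B) x =
      A • Matrix.vecMulVec e e - Matrix.scalar (Fin n) B := by
  ext i j
  rw [hessianMatrix, Matrix.of_apply, fderiv_fderiv_quadTest]
  simp [Matrix.vecMulVec_apply, Matrix.diagonal_apply, EuclideanSpace.inner_single_right,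
    eq_comm]

lemma isSmallTest_quadTest {n : ℕ} {x₀ : EuclideanSpace ℝ (Fin n)} {c ρ : ℝ}
    {p e : EuclideanSpace ℝ (Fin n)} {A B : ℝ} (he : ‖e‖ = 1) (hAB : |A| + |B| ≤ ρ)
    (hp : ‖p‖ ≤ ρ) (hc : |c| ≤ ρ) : IsSmallTest ρ (quadTest x₀ c p e A B) x₀ := by
  refine ⟨(contDiff_quadTest _ _ _ _ _ _).contDiffOn,
    (norm_fderiv_fderiv_quadTest_le _ _ _ he _ _ _).trans hAB, ?_, ?_⟩
  · rwa [norm_fderiv_quadTest_self]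
  · simpa [quadTest] using hc

lemma dotProduct_self_of_norm_eq_one {n : ℕ} {e : EuclideanSpace ℝ (Fin n)} (he : ‖e‖ = 1) :
    (e : Fin n → ℝ) ⬝ᵥ (e : Fin n → ℝ) = 1 := by
  have h := real_inner_self_eq_norm_sq e
  rw [he, one_pow] at h
  rw [← h, PiLp.inner_apply]
  simp [dotProduct, sq]

lemma eventually_nhds_of_add {E : Type*} [NormedAddCommGroup E] {x : E} {P : E → Prop}
    (h : ∀ᶠ v in 𝓝 (0 : E), P (x + v)) : ∀ᶠ z in 𝓝 x, P z := by
  have hc : Tendsto (fun z : E => z - x) (𝓝 x) (𝓝 0) := by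
    have : Continuous fun z : E => z - x := by fun_prop
    simpa using this.tendsto x
  filter_upwards [hc.eventually h] with z hz
  rwa [add_sub_cancel] at hz

/-- With `A = K + κ` and `B = κ`, the Hessian has eigenvalue `K` once and `-κ` with multiplicity `n
- 1`, whence `N = (n - 1) Lam`; the bound `|A| + |B| = K + 2κ` explains the size condition in
`IsQuadSuper`. -/
lemma isQuadSuper_of_mem_pucciSuper {n : ℕ} (hn : 1 ≤ n) {lam Lam b₀ ρ σ : ℝ}
    {u f : EuclideanSpace ℝ (Fin n) → ℝ}
    (hu : u ∈ pucciSuper ρ lam Lam b₀ f) (hu1 : ∀ x ∈ ball 0 1, |u x| ≤ ρ)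
    (hf : ∀ x ∈ ball 0 1, f x ≤ σ) :
    IsQuadSuper lam (((n : ℝ) - 1) * Lam) b₀ ρ σ (ball 0 1) u := by
  intro x hx e p κ K he hκ hK hKκ hp htouch
  have h := hu x hx (quadTest x (u x) p e (K + κ) κ)
    (isSmallTest_quadTest he (by rw [abs_of_nonneg (by linarith), abs_of_nonneg hκ]; linarith)
      hp (hu1 x hx))
    (by simp [quadTest]) (eventually_nhds_of_add (by
      filter_upwards [htouch] with v hv
      simpa [quadTest] using hv))
  rw [norm_fderiv_quadTest_self, hessianMatrix_quadTest, pucciMinus,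
    roots_charpoly_rankOne hn _ _ _ (dotProduct_self_of_norm_eq_one he), add_sub_cancel_right,
    sum_filter_pos_cons_replicate hK hκ, sum_filter_neg_cons_replicate hK hκ,
    Nat.cast_sub hn, Nat.cast_one] at h
  have := hf x hx
  linarith

lemma isQuadSuper_of_mem_pucciSub {n : ℕ} (hn : 1 ≤ n) {lam Lam b₀ ρ σ : ℝ}
    {u f : EuclideanSpace ℝ (Fin n) → ℝ}
    (hu : u ∈ pucciSub ρ lam Lam b₀ f) (hu1 : ∀ x ∈ ball 0 1, |u x| ≤ ρ)
    (hf : ∀ x ∈ ball 0 1, -σ ≤ f x) :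
    IsQuadSuper lam (((n : ℝ) - 1) * Lam) b₀ ρ σ (ball 0 1) (fun x => 1 - u x) := by
  intro x hx e p κ K he hκ hK hKκ hp htouch
  have h := hu x hx (quadTest x (u x) (-p) e (-(K + κ)) (-κ))
    (isSmallTest_quadTest he
      (by rw [abs_neg, abs_neg, abs_of_nonneg (by linarith), abs_of_nonneg hκ]; linarith)
      (by rwa [norm_neg]) (hu1 x hx))
    (by simp [quadTest]) (eventually_nhds_of_add (by
      filter_upwards [htouch] with v hv
      rw [quadTest, add_sub_cancel_left, inner_neg_left]
      linarith))
  rw [norm_fderiv_quadTest_self, hessianMatrix_quadTest, pucciPlus,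
    roots_charpoly_rankOne hn _ _ _ (dotProduct_self_of_norm_eq_one he),
    show -(K + κ) - -κ = -K by ring, neg_neg,
    sum_filter_pos_neg_cons_replicate hK hκ, sum_filter_neg_neg_cons_replicate hK hκ,
    Nat.cast_sub hn, Nat.cast_one, norm_neg] at h
  have := hf x hx
  linarith

end Pucci

/-! ### Conclusion. -/

lemma oscOn_le {n : ℕ} {u : EuclideanSpace ℝ (Fin n) → ℝ} {s : Set (EuclideanSpace ℝ (Fin n))}
    {B : ℝ} (hs : s.Nonempty) (h : ∀ x ∈ s, ∀ y ∈ s, |u x - u y| ≤ B) : oscOn u s ≤ B := by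
  rw [oscOn, sub_le_comm]
  refine le_csInf (hs.image u) ?_
  rintro _ ⟨y, hy, rfl⟩
  rw [sub_le_iff_le_add]
  refine csSup_le (hs.image u) ?_
  rintro _ ⟨x, hx, rfl⟩
  have := (abs_le.1 (h x hx y hy)).2
  linarith

/-- It turns the lower bound on `r` into `16 ≤ ρ r²`, the only property of `rhoZero` that matters
for the scales. -/
lemma eight_le_rhoZero {n : ℕ} (hn : 1 ≤ n) {lam Lam b₀ : ℝ} (hlam : 0 < lam) (hLam : lam ≤ Lam)
    (hb₀ : 0 ≤ b₀) : 8 ≤ rhoZero n lam Lam b₀ := by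
  have h1 : (1 : ℝ) ≤ n := by exact_mod_cast hn
  have h2 : 0 ≤ ((n : ℝ) - 1) * Lam := mul_nonneg (by linarith) (by linarith)
  have h3 : 0 ≤ (((n : ℝ) - 1) * Lam + 2 * b₀ + 1) / lam := by positivity
  rw [rhoZero, gammaConst]
  linarith

theorem theorem2 (n : ℕ) (hn : 1 ≤ n) (lam Lam b₀ : ℝ) (hlam : 0 < lam) (hLam : lam ≤ Lam)
    (hb₀ : 0 ≤ b₀) :
    ∃ σ C α : ℝ, 0 < σ ∧ σ < 1 ∧ 0 < C ∧ 0 < α ∧ α < 1 ∧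
      ∀ (ρ : ℝ) (u f : EuclideanSpace ℝ (Fin n) → ℝ),
        2 * rhoZero n lam Lam b₀ < ρ →
        ContinuousOn u (ball 0 1) →
        u ∈ pucciStar ρ lam Lam b₀ f →
        (∀ x ∈ ball (0 : EuclideanSpace ℝ (Fin n)) 1, 0 ≤ u x) →
        (∀ x ∈ ball (0 : EuclideanSpace ℝ (Fin n)) 1, |u x| ≤ 1) →
        (∀ x ∈ ball (0 : EuclideanSpace ℝ (Fin n)) 1, |f x| ≤ σ) →
        (∀ r : ℝ, √(2 * rhoZero n lam Lam b₀ / ρ) ≤ r → r ≤ 1 →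
          oscOn u (ball 0 r) ≤ C * r ^ α) ∧
        (∀ x₀ ∈ ball (0 : EuclideanSpace ℝ (Fin n)) (1 / 2), ∀ r : ℝ,
          √(2 * rhoZero n lam Lam b₀ / ρ) ≤ r → r ≤ 1 / 2 →
          oscOn u (ball x₀ r) ≤ C * r ^ α) ∧
        (∀ x₁ ∈ ball (0 : EuclideanSpace ℝ (Fin n)) (1 / 2),
          ∀ x₂ ∈ ball (0 : EuclideanSpace ℝ (Fin n)) (1 / 2),
          √(2 * rhoZero n lam Lam b₀ / ρ) ≤ ‖x₁ - x₂‖ → ‖x₁ - x₂‖ ≤ 1 / 2 →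
          |u x₁ - u x₂| ≤ C * ‖x₁ - x₂‖ ^ α) := by
  have hn1 : (1 : ℝ) ≤ n := by exact_mod_cast hn
  have hN : 0 ≤ ((n : ℝ) - 1) * Lam := mul_nonneg (by linarith) (by linarith)
  obtain ⟨σ, C, α, hσ, hσ1, hC, hCα, hα0, hα1, hmain⟩ :=
    exists_holder_estimate (EuclideanSpace ℝ (Fin n)) hlam hN hb₀
  refine ⟨σ, C, α, hσ, hσ1, hC, hα0, hα1, fun ρ u f hρ hu hstar hu0 hu1 hf => ?_⟩
  have hρ₀ := eight_le_rhoZero hn hlam hLam hb₀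
  have hρ0 : 0 < ρ := by linarith
  have huρ : ∀ x ∈ ball (0 : EuclideanSpace ℝ (Fin n)) 1, |u x| ≤ ρ := fun x hx =>
    (hu1 x hx).trans (by linarith)
  have hu01 : ∀ x ∈ ball (0 : EuclideanSpace ℝ (Fin n)) 1, 0 ≤ u x ∧ u x ≤ 1 := fun x hx =>
    ⟨hu0 x hx, (abs_le.1 (hu1 x hx)).2⟩
  have key := hmain ρ u hu hu01 (isQuadSuper_of_mem_pucciSuper hn hstar.2 huρ hf)
    (isQuadSuper_of_mem_pucciSub hn hstar.1 huρ fun x hx => neg_le_neg (hf x hx))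
  have hscale : ∀ r, √(2 * rhoZero n lam Lam b₀ / ρ) ≤ r → 0 < r ∧ 16 ≤ ρ * r ^ 2 := by
    intro r hr
    have hr0 : 0 < r := lt_of_lt_of_le (Real.sqrt_pos.2 (by positivity)) hr
    refine ⟨hr0, ?_⟩
    have h1 := (Real.sqrt_le_left hr0.le).1 hr
    rw [div_le_iff₀ hρ0] at h1
    linarith
  have hball : ∀ x₀ : EuclideanSpace ℝ (Fin n), ‖x₀‖ ≤ 1 / 2 → ∀ r ≤ (1 / 2 : ℝ),
      ball x₀ r ⊆ closedBall x₀ r ∩ ball 0 1 := by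
    intro x₀ hx₀ r hr x hx
    refine ⟨ball_subset_closedBall hx, ?_⟩
    rw [mem_ball_iff_norm] at hx
    rw [mem_ball_zero_iff]
    have := norm_add_le (x - x₀) x₀
    rw [sub_add_cancel] at this
    linarith
  have hosc : ∀ x₀ : EuclideanSpace ℝ (Fin n), ‖x₀‖ ≤ 1 / 2 → ∀ r : ℝ,
      √(2 * rhoZero n lam Lam b₀ / ρ) ≤ r → r ≤ 1 / 2 → oscOn u (ball x₀ r) ≤ C * r ^ α := by
    intro x₀ hx₀ r hr hr2
    obtain ⟨hr0, hρr⟩ := hscale r hr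
    exact oscOn_le (nonempty_ball.2 hr0) fun x hx y hy =>
      key x₀ hx₀ r hr0 hρr x (hball x₀ hx₀ r hr2 hx) y (hball x₀ hx₀ r hr2 hy)
  refine ⟨fun r hr hr1 => ?_, fun x₀ hx₀ r hr hr2 => hosc x₀ (mem_ball_zero_iff.1 hx₀).le r hr hr2,
    fun x₁ hx₁ x₂ hx₂ hr hr2 => ?_⟩
  · rcases le_or_gt r (1 / 2) with hr2 | hr2
    · exact hosc 0 (by simp) r hr hr2
    -- For `r > 1/2` the ball need not satisfy the containment `hball`, but the oscillation is at
    -- most `1 ≤ C (1/2)^α`.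
    · refine oscOn_le (nonempty_ball.2 (hscale r hr).1) fun x hx y hy => ?_
      have h1 := hu01 x (ball_subset_ball hr1 hx)
      have h2 := hu01 y (ball_subset_ball hr1 hy)
      calc |u x - u y| ≤ 1 := by rw [abs_le]; constructor <;> linarith
        _ ≤ C * (1 / 2) ^ α := hCα
        _ ≤ C * r ^ α := by gcongr
  · obtain ⟨hr0, hρr⟩ := hscale _ hr
    rw [mem_ball_zero_iff] at hx₁ hx₂
    refine key x₁ hx₁.le _ hr0 hρr x₁ ⟨mem_closedBall_self hr0.le, ?_⟩ x₂ ⟨?_, ?_⟩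
    · rw [mem_ball_zero_iff]; linarith
    · rw [mem_closedBall_iff_norm, norm_sub_rev]
    · rw [mem_ball_zero_iff]; linarith
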